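/- Let $w=\{w_k\}_{k\ge 1}$ be a sequence of positive numbers with $w_k\to 1$ and $\sup_{k\ge1}(k+1)|w_k-1|<\infty$. Put $\beta_0=1$, $\beta_k=\prod_{j=1}^k w_j$, and let $H^2_\beta$ be the Hilbert space of analytic functions $f(z)=\sum_{k\ge0}\widehat f(k)z^k$ on the open unit disc $\mathbb D$ with $\|f\|^2=\sum_{k\ge0}|\widehat f(k)|^2\beta_k^2<\infty$ (a weighted Hardy space of polynomial growth). Let $H^\infty_\beta$ be the set of functions $f$ on $\mathbb D$ for which $M_f g=fg$ defines a bounded operator $M_f$ on $H^2_\beta$; it contains the set $\mathrm{Hol}(\overline{\mathbb D})$ of functions analytic on (a neighbourhood of) the closed disc. Write $\{T\}'$ for the commutant of $T$ in the algebra of bounded operators on $H^2_\beta$, $S\sim T$ if $XSX^{-1}=T$ for some bounded invertible operator $X$ on $H^2_\beta$, and $\mathrm{Aut}(\mathbb D)$ for the set of analytic bijections of $\mathbb D$ onto itself (Möbius transformations). (1) Let $h_1,h_2\in\mathrm{Hol}(\overline{\mathbb D})$ with $\{M_{h_1}\}'=\{M_{h_2}\}'=\{M_z\}'$. Then $M_{h_1}\sim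 M_{h_2}$ if and only if there is $\varphi\in\mathrm{Aut}(\mathbb D)$ such that $h_2=h_1\circ\varphi$ on $\mathbb D$. (2) Let $\psi\in H^\infty_\beta$ be analytic on $\mathbb D$. If $M_z\sim M_\psi$, then $\psi\in\mathrm{Aut}(\mathbb D)$. (3) Let $\psi$ be analytic on $\mathbb D$ with $\psi(\mathbb D)\subseteq\mathbb D$. If the composition operator $C_\psi f=f\circ\psi$ is a bounded invertible operator on $H^2_\beta$, then $\psi\in\mathrm{Aut}(\mathbb D)$. -/

import Mathlib

open Filter Topology

noncomputable section

/-- A weight sequence `w₁, w₂, …` of positive reals with `w_k → 1`; the value at `0` is not used. -/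
structure WeightSeq where
  /-- the sequence -/
  w : ℕ → ℝ
  pos : ∀ k, 1 ≤ k → 0 < w k
  tendsto_one : Tendsto w atTop (𝓝 1)

namespace WeightSeq

/-- `β_k = w₁ ⋯ w_k`, with `β₀ = 1`. -/
def beta (w : WeightSeq) (k : ℕ) : ℝ := ∏ j ∈ Finset.Icc 1 k, w.w j

/-- Polynomial growth: `sup_{k ≥ 1} (k + 1) |w_k - 1| < ∞`. -/
def PolynomialGrowth (w : WeightSeq) : Prop :=
  ∃ K : ℝ, ∀ k : ℕ, 1 ≤ k → ((k : ℝ) + 1) * |w.w k - 1| ≤ K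

theorem beta_pos (w : WeightSeq) (k : ℕ) : 0 < w.beta k :=
  Finset.prod_pos fun j hj => w.pos j (Finset.mem_Icc.1 hj).1

theorem beta_succ (w : WeightSeq) (k : ℕ) : w.beta (k + 1) = w.beta k * w.w (k + 1) := by
  unfold beta
  rw [Finset.prod_Icc_succ_top (by omega)]

end WeightSeq

/-- The weighted Hardy space `H²_β`. Its elements are the power series `∑ c_k z^k` with
`∑ |c_k|² β_k² < ∞`, each given by its sequence of Taylor coefficients; the analytic function on
the unit disc is `HardySpace.eval`. -/
def HardySpace (w : WeightSeq) : Type :=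
  {c : ℕ → ℂ // Summable fun k => ‖c k‖ ^ 2 * w.beta k ^ 2}

namespace HardySpace

variable {w : WeightSeq}

/-- The `k`-th Taylor coefficient. -/
def coeff (f : HardySpace w) (k : ℕ) : ℂ := f.1 k

/-- The value at `z` of the function with the given Taylor coefficients. -/
def eval (f : HardySpace w) (z : ℂ) : ℂ := ∑' k, f.coeff k * z ^ k

theorem memlp_iff (c : ℕ → ℂ) :
    Memℓp (fun k => (w.beta k : ℂ) * c k) 2 ↔ Summable fun k => ‖c k‖ ^ 2 * w.beta k ^ 2 := by
  rw [memℓp_gen_iff (by norm_num)]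
  refine summable_congr fun k => ?_
  simp [abs_of_pos (w.beta_pos k), mul_pow, mul_comm]

/-- The bijection `c ↦ (β_k c_k)_k` of `H²_β` onto `ℓ²`. -/
def equivLp (w : WeightSeq) : HardySpace w ≃ lp (fun _ : ℕ => ℂ) 2 where
  toFun f := ⟨fun k => (w.beta k : ℂ) * f.1 k, (memlp_iff f.1).2 f.2⟩
  invFun a := ⟨fun k => (w.beta k : ℂ)⁻¹ * a k, (memlp_iff _).1 (by
    have h : (fun k => (w.beta k : ℂ) * ((w.beta k : ℂ)⁻¹ * a k)) = fun k => a k := by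
      funext k
      rw [mul_inv_cancel_left₀ (by exact_mod_cast (w.beta_pos k).ne')]
    rw [h]; exact lp.memℓp a)⟩
  left_inv f := by
    apply Subtype.ext
    funext k
    exact inv_mul_cancel_left₀ (by exact_mod_cast (w.beta_pos k).ne') _
  right_inv a := by
    apply Subtype.ext
    funext k
    exact mul_inv_cancel_left₀ (by exact_mod_cast (w.beta_pos k).ne') _

instance : AddCommGroup (HardySpace w) := (equivLp w).addCommGroup

instance : Module ℂ (HardySpace w) := (equivLp w).module ℂ

/-- `equivLp` as a linear equivalence. -/
def linearEquivLp (w : WeightSeq) : HardySpace w ≃ₗ[ℂ] lp (fun _ : ℕ => ℂ) 2 :=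
  (equivLp w).linearEquiv ℂ

instance : NormedAddCommGroup (HardySpace w) :=
  NormedAddCommGroup.induced _ _ (linearEquivLp w) (linearEquivLp w).injective

/-- The inner product `∑ β_k² conj(f_k) g_k` (linear in the second variable), transported
from `ℓ²`. -/
instance : InnerProductSpace ℂ (HardySpace w) where
  norm_smul_le c f := by
    change ‖linearEquivLp w (c • f)‖ ≤ ‖c‖ * ‖linearEquivLp w f‖
    rw [map_smul]; exact norm_smul_le _ _
  inner f g := inner ℂ (linearEquivLp w f) (linearEquivLp w g)
  norm_sq_eq_re_inner f := norm_sq_eq_re_inner (𝕜 := ℂ) (linearEquivLp w f)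
  conj_inner_symm f g := inner_conj_symm _ _
  add_left f g h := by
    change inner ℂ (linearEquivLp w (f + g)) _ = _
    rw [map_add]; exact inner_add_left _ _ _
  smul_left f g c := by
    change inner ℂ (linearEquivLp w (c • f)) _ = _
    rw [map_smul]; exact inner_smul_left _ _ _

/-- `equivLp` is an isometry. -/
def isometryLp (w : WeightSeq) : HardySpace w ≃ₗᵢ[ℂ] lp (fun _ : ℕ => ℂ) 2 where
  toLinearEquiv := linearEquivLp w
  norm_map' _ := rfl

instance : CompleteSpace (HardySpace w) :=
  (completeSpace_congr (e := (isometryLp w).toEquiv)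
    (isometryLp w).isometry.isUniformEmbedding).2 inferInstance

theorem isometryLp_apply (f : HardySpace w) (k : ℕ) :
    isometryLp w f k = (w.beta k : ℂ) * f.coeff k := rfl

theorem beta_ne (w : WeightSeq) (k : ℕ) : (w.beta k : ℂ) ≠ 0 := by
  exact_mod_cast (w.beta_pos k).ne'

theorem coeff_add (f g : HardySpace w) (k : ℕ) : (f + g).coeff k = f.coeff k + g.coeff k := by
  apply mul_left_cancel₀ (beta_ne w k)
  rw [mul_add, ← isometryLp_apply, ← isometryLp_apply, ← isometryLp_apply, map_add]; rfl

theorem coeff_smul (c : ℂ) (f : HardySpace w) (k : ℕ) : (c • f).coeff k = c * f.coeff k := by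
  apply mul_left_cancel₀ (beta_ne w k)
  rw [mul_left_comm, ← isometryLp_apply, ← isometryLp_apply, map_smul]; rfl

theorem norm_sq_eq (f : HardySpace w) : ‖f‖ ^ 2 = ∑' k, ‖f.coeff k‖ ^ 2 * w.beta k ^ 2 := by
  have h := lp.norm_rpow_eq_tsum (p := 2) (by norm_num) (isometryLp w f)
  rw [LinearIsometryEquiv.norm_map] at h
  norm_num at h
  rw [h]
  refine tsum_congr fun k => ?_
  simp [isometryLp_apply, abs_of_pos (w.beta_pos k), mul_pow, mul_comm]

theorem inner_eq (f g : HardySpace w) :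
    inner ℂ f g = ∑' k, (w.beta k : ℂ) ^ 2 * (starRingEnd ℂ (f.coeff k) * g.coeff k) := by
  change inner ℂ (isometryLp w f) (isometryLp w g) = _
  rw [lp.inner_eq_tsum]
  refine tsum_congr fun k => ?_
  simp [isometryLp_apply]
  ring


/-! Evaluation at a point of the disc is a convergent series, continuous in the function. -/

theorem evalVec_memlp (w : WeightSeq) {z : ℂ} (hz : z ∈ Metric.ball (0 : ℂ) 1) :
    Memℓp (fun k => starRingEnd ℂ ((w.beta k : ℂ)⁻¹ * z ^ k)) 2 := by
  rw [memℓp_gen_iff (by norm_num)]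
  have hz1 : ‖z‖ ^ 2 < 1 := by
    have : ‖z‖ < 1 := by simpa using hz
    nlinarith [norm_nonneg z]
  obtain ⟨r, hr, hr1⟩ := exists_between hz1
  have hlim : Tendsto (fun k => ‖z‖ ^ 2 / w.w (k + 1) ^ 2) atTop (𝓝 (‖z‖ ^ 2)) := by
    have h := (tendsto_add_atTop_iff_nat 1).2 w.tendsto_one
    have h2 := (tendsto_const_nhds (x := ‖z‖ ^ 2)).div (h.pow 2) (by norm_num)
    rw [one_pow, div_one] at h2
    exact h2
  refine summable_of_ratio_norm_eventually_le hr1 ?_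
  filter_upwards [hlim.eventually (gt_mem_nhds hr)] with k hk
  have hb := w.beta_pos k
  have hw := w.pos (k + 1) (by omega)
  have e : ∀ j, ‖‖starRingEnd ℂ ((w.beta j : ℂ)⁻¹ * z ^ j)‖ ^ (2 : ENNReal).toReal‖
      = (w.beta j)⁻¹ ^ 2 * (‖z‖ ^ j) ^ 2 := by
    intro j
    simp [abs_of_pos (w.beta_pos j), mul_pow]
  rw [e, e, w.beta_succ]
  have : (w.beta k * w.w (k + 1))⁻¹ ^ 2 * (‖z‖ ^ (k + 1)) ^ 2
      = (‖z‖ ^ 2 / w.w (k + 1) ^ 2) * ((w.beta k)⁻¹ ^ 2 * (‖z‖ ^ k) ^ 2) := by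
    field_simp
    ring
  rw [this]
  exact mul_le_mul_of_nonneg_right hk.le (by positivity)

/-- Evaluation at a point of the disc as a continuous linear functional. -/
def evalCLM (w : WeightSeq) {z : ℂ} (hz : z ∈ Metric.ball (0 : ℂ) 1) : HardySpace w →L[ℂ] ℂ :=
  (innerSL ℂ (⟨_, evalVec_memlp w hz⟩ : lp (fun _ : ℕ => ℂ) 2)).comp
    ((isometryLp w).toContinuousLinearEquiv : HardySpace w →L[ℂ] lp (fun _ : ℕ => ℂ) 2)

theorem hasSum_eval {z : ℂ} (hz : z ∈ Metric.ball (0 : ℂ) 1) (f : HardySpace w) :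
    HasSum (fun k => f.coeff k * z ^ k) (evalCLM w hz f) := by
  have h := lp.hasSum_inner (𝕜 := ℂ) (⟨_, evalVec_memlp w hz⟩ : lp (fun _ : ℕ => ℂ) 2)
    (isometryLp w f)
  refine Eq.subst (motive := fun F => HasSum F _) (funext fun k => ?_) (h)
  change inner ℂ (starRingEnd ℂ ((w.beta k : ℂ)⁻¹ * z ^ k)) ((w.beta k : ℂ) * f.coeff k) = _
  rw [RCLike.inner_apply, Complex.conj_conj]
  field_simp [beta_ne w k]

theorem evalCLM_apply {z : ℂ} (hz : z ∈ Metric.ball (0 : ℂ) 1) (f : HardySpace w) :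
    evalCLM w hz f = f.eval z := (hasSum_eval hz f).tsum_eq.symm

/-! Powers of the shift are bounded. -/

theorem beta_growth (w : WeightSeq) {q : ℝ} (hq : 1 < q) :
    ∃ C : ℝ, 0 ≤ C ∧ ∀ n k, w.beta (n + k) ≤ C * q ^ k * w.beta n := by
  have hq0 : 0 < q := by linarith
  obtain ⟨N, hN⟩ := (w.tendsto_one.eventually (gt_mem_nhds hq)).exists_forall_of_atTop
  let D : ℕ → ℝ := fun n => ∏ j ∈ Finset.range n, max 1 (w.w (j + 1) / q)
  have D1 : ∀ n, D (n + 1) = D n * max 1 (w.w (n + 1) / q) := fun n => Finset.prod_range_succ _ _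
  have Dp : ∀ n, 1 ≤ D n := by
    intro n
    induction n with
    | zero => simp [D]
    | succ n ih => rw [D1]; nlinarith [le_max_left 1 (w.w (n + 1) / q)]
  have Dm : Monotone D := monotone_nat_of_le_succ fun n => by
    rw [D1]; nlinarith [Dp n, le_max_left 1 (w.w (n + 1) / q)]
  have Dc : ∀ n, N ≤ n → D n ≤ D N := by
    intro n hn
    induction n, hn using Nat.le_induction with
    | base => exact le_rfl
    | succ n hn ih =>
      have : w.w (n + 1) / q ≤ 1 := (div_le_one hq0).2 (hN (n + 1) (by omega)).le
      rw [D1, max_eq_left this, mul_one]; exact ih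
  have Db : ∀ n, D n ≤ D N := fun n => (le_total n N).elim (fun h => Dm h) (Dc n)
  refine ⟨D N, by linarith [Dp N], fun n k => ?_⟩
  have key : w.beta (n + k) * D n ≤ q ^ k * w.beta n * D (n + k) := by
    induction k with
    | zero => simp
    | succ k ih =>
      rw [← add_assoc, w.beta_succ, D1]
      have hw := w.pos (n + k + 1) (by omega)
      have h1 : w.w (n + k + 1) ≤ q * max 1 (w.w (n + k + 1) / q) := by
        have := le_max_right 1 (w.w (n + k + 1) / q)
        rwa [div_le_iff₀' hq0] at this
      calc w.beta (n + k) * w.w (n + k + 1) * D n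
          = w.beta (n + k) * D n * w.w (n + k + 1) := by ring
        _ ≤ q ^ k * w.beta n * D (n + k) * (q * max 1 (w.w (n + k + 1) / q)) := by
            apply mul_le_mul ih h1 hw.le
            have := w.beta_pos n
            have := Dp (n + k)
            positivity
        _ = _ := by ring
  have hb := w.beta_pos n
  have hb2 := w.beta_pos (n + k)
  calc w.beta (n + k) ≤ w.beta (n + k) * D n := le_mul_of_one_le_right hb2.le (Dp n)
    _ ≤ q ^ k * w.beta n * D (n + k) := key
    _ ≤ q ^ k * w.beta n * D N := mul_le_mul_of_nonneg_left (Db _) (by positivity)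
    _ = _ := by ring

theorem shift_summable (w : WeightSeq) (k : ℕ) (f : HardySpace w) :
    Summable fun n => ‖if n < k then 0 else f.coeff (n - k)‖ ^ 2 * w.beta n ^ 2 := by
  obtain ⟨C, hC, h⟩ := beta_growth w one_lt_two
  rw [← summable_nat_add_iff k]
  refine Summable.of_nonneg_of_le (fun n => by positivity) (fun n => ?_)
    (f.2.mul_left ((C * 2 ^ k) ^ 2))
  have hb := w.beta_pos (n + k)
  have := pow_le_pow_left₀ hb.le (h n k) 2
  simp only [add_lt_iff_neg_right, not_lt_zero, if_false, add_tsub_cancel_right]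
  calc ‖f.coeff n‖ ^ 2 * w.beta (n + k) ^ 2
      ≤ ‖f.coeff n‖ ^ 2 * (C * 2 ^ k * w.beta n) ^ 2 := by gcongr
    _ = (C * 2 ^ k) ^ 2 * (‖f.1 n‖ ^ 2 * w.beta n ^ 2) := by unfold coeff; ring

/-- The power series multiplied by `z ^ k`. -/
def shiftFun (w : WeightSeq) (k : ℕ) (f : HardySpace w) : HardySpace w :=
  ⟨fun n => if n < k then 0 else f.coeff (n - k), shift_summable w k f⟩

theorem ext_coeff {f g : HardySpace w} (h : ∀ k, f.coeff k = g.coeff k) : f = g :=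
  Subtype.ext (funext h)

theorem coeff_shiftFun (k n : ℕ) (f : HardySpace w) :
    (shiftFun w k f).coeff n = if n < k then 0 else f.coeff (n - k) := rfl

theorem shift_bound (k : ℕ) (f : HardySpace w) {A : ℝ} (hA : 0 ≤ A)
    (h : ∀ n, w.beta (n + k) ≤ A * w.beta n) : ‖shiftFun w k f‖ ≤ A * ‖f‖ := by
  refine le_of_sq_le_sq ?_ (by positivity)
  rw [mul_pow, norm_sq_eq, norm_sq_eq]
  simp only [coeff_shiftFun]
  rw [← (shift_summable w k f).sum_add_tsum_nat_add k, ← tsum_mul_left]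
  have h0 : ∑ i ∈ Finset.range k, ‖if i < k then 0 else f.coeff (i - k)‖ ^ 2 * w.beta i ^ 2 = 0 :=
    Finset.sum_eq_zero fun i hi => by simp [Finset.mem_range.1 hi]
  rw [h0, zero_add]
  refine Summable.tsum_le_tsum (fun n => ?_)
    ((summable_nat_add_iff k).2 (shift_summable w k f)) (Summable.mul_left _ f.2)
  have hb := w.beta_pos (n + k)
  have := pow_le_pow_left₀ hb.le (h n) 2
  simp only [add_lt_iff_neg_right, not_lt_zero, if_false, add_tsub_cancel_right]
  calc ‖f.coeff n‖ ^ 2 * w.beta (n + k) ^ 2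
      ≤ ‖f.coeff n‖ ^ 2 * (A * w.beta n) ^ 2 := by gcongr
    _ = A ^ 2 * (‖f.coeff n‖ ^ 2 * w.beta n ^ 2) := by ring

theorem exists_shift (w : WeightSeq) (k : ℕ) :
    ∃ S : HardySpace w →L[ℂ] HardySpace w, ∀ f, S f = shiftFun w k f := by
  obtain ⟨C, hC, h⟩ := beta_growth w one_lt_two
  refine ⟨LinearMap.mkContinuous
    { toFun := shiftFun w k
      map_add' := fun f g => ext_coeff fun n => ?_
      map_smul' := fun c f => ext_coeff fun n => ?_ } (C * 2 ^ k)
      fun f => shift_bound k f (by positivity) fun n => h n k, fun f => rfl⟩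
  · rw [coeff_add]; simp only [coeff_shiftFun, coeff_add]; split_ifs <;> simp
  · simp only [coeff_smul, coeff_shiftFun, RingHom.id_apply]; split_ifs <;> simp

theorem evalCLM_shift {z : ℂ} (hz : z ∈ Metric.ball (0 : ℂ) 1) (k : ℕ) (f : HardySpace w) :
    evalCLM w hz (shiftFun w k f) = z ^ k * evalCLM w hz f := by
  have h := hasSum_eval hz (shiftFun w k f)
  have h' := (hasSum_nat_add_iff' k).2 h
  have h0 : ∑ i ∈ Finset.range k, (shiftFun w k f).coeff i * z ^ i = 0 :=
    Finset.sum_eq_zero fun i hi => by simp [coeff_shiftFun, Finset.mem_range.1 hi]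
  rw [h0, sub_zero] at h'
  refine h'.unique ?_
  refine Eq.subst (motive := fun F => HasSum F _) (funext fun n => ?_) (((hasSum_eval hz f).mul_left (z ^ k)))
  simp only [coeff_shiftFun, add_lt_iff_neg_right, not_lt_zero, if_false, add_tsub_cancel_right]
  ring

theorem eq_of_eval {f g : HardySpace w}
    (h : ∀ z ∈ Metric.ball (0 : ℂ) 1, f.eval z = g.eval z) : f = g := by
  have hp : ∀ e : HardySpace w, HasFPowerSeriesAt f.eval
      (FormalMultilinearSeries.ofScalars ℂ e.coeff) 0 ↔ ∀ᶠ z in 𝓝 (0 : ℂ),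
      HasSum (fun n => e.coeff n * z ^ n) (f.eval z) := by
    intro e
    rw [hasFPowerSeriesAt_iff]
    simp [FormalMultilinearSeries.coeff_ofScalars, mul_comm]
  have hball : ∀ᶠ z in 𝓝 (0 : ℂ), z ∈ Metric.ball (0 : ℂ) 1 := Metric.ball_mem_nhds 0 one_pos
  have hf := (hp f).2 (hball.mono fun z hz => by
    rw [← evalCLM_apply hz]; exact hasSum_eval hz f)
  have hg := (hp g).2 (hball.mono fun z hz => by
    rw [h z hz, ← evalCLM_apply hz]; exact hasSum_eval hz g)
  have := hf.eq_formalMultilinearSeries hg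
  refine ext_coeff fun k => ?_
  have hk := congrArg (fun q => FormalMultilinearSeries.coeff q k) this
  simpa [FormalMultilinearSeries.coeff_ofScalars] using hk

end HardySpace

open HardySpace

/-- `T` is the operator of multiplication by `f` on `H²_β`: `(T g)(z) = f(z) g(z)` on the disc. -/
def IsMulOp (w : WeightSeq) (f : ℂ → ℂ) (T : HardySpace w →L[ℂ] HardySpace w) : Prop :=
  ∀ g : HardySpace w, ∀ z ∈ Metric.ball (0 : ℂ) 1, (T g).eval z = f z * g.eval z

/-- `H^∞_β`: the functions `f` on the disc for which multiplication by `f` is a bounded operator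
from `H²_β` to `H²_β` (such an `f` is itself in `H²_β`, being the image of the function `1`). -/
def HInfty (w : WeightSeq) : Set (ℂ → ℂ) := {f | ∃ T, IsMulOp w f T}

/-- `Hol(𝔻̄)`: the functions analytic on (a neighbourhood of) the closed unit disc. -/
def HolClosedDisc : Set (ℂ → ℂ) := {h | AnalyticOnNhd ℂ h (Metric.closedBall 0 1)}

/-- The multiplication operator `M_f` on `H²_β` for `f ∈ H^∞_β`. -/
def mulOp (w : WeightSeq) (f : ℂ → ℂ) (hf : f ∈ HInfty w) : HardySpace w →L[ℂ] HardySpace w :=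
  hf.choose

theorem mulOp_spec (w : WeightSeq) {f : ℂ → ℂ} (hf : f ∈ HInfty w) :
    IsMulOp w f (mulOp w f hf) := hf.choose_spec

theorem IsMulOp.unique {w : WeightSeq} {f : ℂ → ℂ} {S T : HardySpace w →L[ℂ] HardySpace w}
    (hS : IsMulOp w f S) (hT : IsMulOp w f T) : S = T :=
  ContinuousLinearMap.ext fun g => eq_of_eval fun z hz => by rw [hS g z hz, hT g z hz]

theorem HolClosedDisc.subset_HInfty (w : WeightSeq) : HolClosedDisc ⊆ HInfty w := by
  intro h hh
  obtain ⟨δ, hδ, hsub⟩ := (isCompact_closedBall (0 : ℂ) 1).exists_thickening_subset_open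
    (isOpen_analyticAt ℂ h) hh
  rw [thickening_closedBall hδ zero_le_one] at hsub
  obtain ⟨q, hq1, hq⟩ := exists_between (show (1 : ℝ) < 1 + δ / 2 by linarith)
  lift q to NNReal using by linarith
  obtain ⟨R, hR⟩ : ∃ R : NNReal, (R : ℝ) = 1 + δ / 2 := ⟨⟨1 + δ / 2, by positivity⟩, rfl⟩
  have hd : DifferentiableOn ℂ h (Metric.closedBall 0 R) := fun z hz =>
    (hsub (by simp at hz ⊢; linarith)).differentiableAt.differentiableWithinAt
  have hp := hd.hasFPowerSeriesOnBall (by rw [← NNReal.coe_pos, hR]; positivity)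
  set p := cauchyPowerSeries h 0 R
  have hs : Summable fun n => ‖p n‖ * (q : ℝ) ^ n := by
    refine p.summable_norm_mul_pow (lt_of_lt_of_le ?_ hp.r_le)
    rw [ENNReal.coe_lt_coe, ← NNReal.coe_lt_coe, hR]; exact hq
  obtain ⟨C, hC, hβ⟩ := beta_growth w hq1
  choose S hS using exists_shift w
  have hSn : ∀ k, ‖S k‖ ≤ C * (q : ℝ) ^ k := fun k =>
    ContinuousLinearMap.opNorm_le_bound _ (by positivity) fun f => by
      rw [hS]; exact shift_bound k f (by positivity) fun n => hβ n k
  have hsum : Summable fun k => p.coeff k • S k := by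
    refine Summable.of_norm_bounded (hs.mul_left C) fun k => ?_
    rw [norm_smul, ← FormalMultilinearSeries.norm_apply_eq_norm_coef]
    calc ‖p k‖ * ‖S k‖ ≤ ‖p k‖ * (C * (q : ℝ) ^ k) := by gcongr; exact hSn k
      _ = _ := by ring
  refine ⟨∑' k, p.coeff k • S k, fun g z hz => ?_⟩
  rw [← evalCLM_apply hz, ← evalCLM_apply hz]
  have h1 : HasSum (fun k => evalCLM w hz ((p.coeff k • S k) g))
      (evalCLM w hz ((∑' k, p.coeff k • S k) g)) :=
    ((hsum.hasSum.mapL (ContinuousLinearMap.apply ℂ (HardySpace w) g)).mapL (evalCLM w hz))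
  have h2 : HasSum (fun k => z ^ k * p.coeff k) (h z) := by
    have hzR : z ∈ Metric.eball (0 : ℂ) R := by
      rw [Metric.eball_coe, hR]
      exact Metric.ball_subset_ball (by linarith) hz
    have := hp.hasSum hzR
    simpa [FormalMultilinearSeries.apply_eq_pow_smul_coeff] using this
  refine h1.unique ?_
  refine Eq.subst (motive := fun F => HasSum F _) (funext fun k => ?_) ((h2.mul_right (evalCLM w hz g)))
  rw [smul_apply, map_smul, hS, evalCLM_shift, smul_eq_mul]
  ring

/-- The commutant `{T}'` of a bounded operator `T` on `H²_β`, inside the bounded operators. -/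
def commutant {w : WeightSeq} (T : HardySpace w →L[ℂ] HardySpace w) :
    Set (HardySpace w →L[ℂ] HardySpace w) := Set.centralizer {T}

/-- Similarity `S ∼ T`: `X S = T X`, that is `X S X⁻¹ = T`, for a bounded invertible `X`. -/
def OpSimilar {w : WeightSeq} (S T : HardySpace w →L[ℂ] HardySpace w) : Prop :=
  ∃ X : HardySpace w ≃L[ℂ] HardySpace w, ∀ f, X (S f) = T (X f)

/-- `φ ∈ Aut(𝔻)`, a Möbius transformation of the disc: `φ` is an analytic bijection of the open
unit disc onto itself. -/
def IsDiscAut (φ : ℂ → ℂ) : Prop :=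
  AnalyticOnNhd ℂ φ (Metric.ball 0 1) ∧ Set.BijOn φ (Metric.ball 0 1) (Metric.ball 0 1)

/-- The composition operator `C_ψ f = f ∘ ψ`, for `ψ` mapping the disc into itself, is a bounded
invertible operator on `H²_β`. -/
def CompBoundedInvertible (w : WeightSeq) (ψ : ℂ → ℂ) : Prop :=
  ∃ X : HardySpace w ≃L[ℂ] HardySpace w,
    ∀ f : HardySpace w, ∀ z ∈ Metric.ball (0 : ℂ) 1, (X f).eval z = f.eval (ψ z)

theorem id_mem_HolClosedDisc : (fun z : ℂ => z) ∈ HolClosedDisc := analyticOnNhd_id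

/-- `M_h` for `h ∈ Hol(𝔻̄)`. -/
def mulHol (w : WeightSeq) (h : ℂ → ℂ) (hh : h ∈ HolClosedDisc) :
    HardySpace w →L[ℂ] HardySpace w := mulOp w h (HolClosedDisc.subset_HInfty w hh)

/-- `M_z`. -/
def mulZ (w : WeightSeq) : HardySpace w →L[ℂ] HardySpace w :=
  mulHol w (fun z => z) id_mem_HolClosedDisc

end

/-! Rigidity. Suppose `X` is invertible and intertwines `M_z` with `M_ψ`. Evaluation at `z` composed
with `X` is then an eigenvector of the adjoint of `M_z`, with eigenvalue `ψ z`. Powers of `M_z` grow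
subexponentially, so `|ψ z| ≤ 1`; the open mapping theorem makes this strict, since a constant `ψ`
would make `M_z` scalar. Density of polynomials shows that such an eigenvector is a multiple of
evaluation at `ψ z`, so `X` is a weighted composition operator. The operator `X⁻¹ M_z X` commutes
with `M_z`, hence is multiplication by some `φ`, and `X⁻¹` is a weighted composition operator with
symbol `φ`. Thus `φ` inverts `ψ`. This is (2). For (3), `C_ψ` intertwines `M_z` with `M_ψ`. For the
forward half of (1), `X M_z X⁻¹` lies in `{M_{h₂}}' = {M_z}'`, so it is multiplication by an
automorphism `φ`, and comparing symbols gives `h₂ = h₁ ∘ φ`.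

Existence. The converse in (1) needs `C_φ` bounded for every automorphism `φ`. Rotations act
isometrically, and Schwarz's lemma writes `φ` as rotations composed with `φ_a(z) = (z + a) / (1 + a
z)`, `0 ≤ a < 1`. For a polynomial `p`, `u = p ∘ φ_a` solves `(1 - a²) ∂_a u = (1 - z²) ∂_z u`. The
generator is unbounded, but polynomial growth lets summation by parts cancel the factor `k` in the
real part of its quadratic form, which is therefore bounded by a multiple of `‖u‖²`. Gronwall's
inequality then bounds `‖p ∘ φ_a‖` by a multiple of `‖p‖`, uniformly in `p`. -/

noncomputable section

open HardySpace

/-! ### Monomials, and analyticity on the disc -/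

namespace HardySpace

variable {w : WeightSeq}

/-- The monomial `z ^ k` as an element of `H²_β`. -/
def monomial (w : WeightSeq) (k : ℕ) : HardySpace w :=
  ⟨fun n => if n = k then 1 else 0, summable_of_ne_finset_zero (s := {k}) fun n hn => by
    simp [Finset.notMem_singleton.1 hn]⟩

theorem coeff_monomial (k n : ℕ) : (monomial w k).coeff n = if n = k then 1 else 0 := rfl

theorem isometryLp_smul_monomial (k : ℕ) (c : ℂ) :
    isometryLp w (c • monomial w k) = lp.single 2 k ((w.beta k : ℂ) * c) := by
  ext n
  rw [isometryLp_apply, coeff_smul, coeff_monomial, lp.single_apply]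
  by_cases h : n = k
  · subst h; simp
  · simp [h]

theorem hasSum_monomial (f : HardySpace w) : HasSum (fun k => f.coeff k • monomial w k) f := by
  have h := lp.hasSum_single (p := 2) (by norm_num) (isometryLp w f)
  have h2 := h.mapL ((isometryLp w).symm.toContinuousLinearEquiv :
    lp (fun _ : ℕ => ℂ) 2 →L[ℂ] HardySpace w)
  simp only [isometryLp_apply, ← isometryLp_smul_monomial] at h2
  simpa using h2

theorem clm_ext_monomial {E : Type*} [NormedAddCommGroup E] [NormedSpace ℂ E]
    {S T : HardySpace w →L[ℂ] E} (h : ∀ k, S (monomial w k) = T (monomial w k)) : S = T := by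
  ext f
  refine ((hasSum_monomial f).mapL S).unique ?_
  simpa [h] using (hasSum_monomial f).mapL T

theorem eval_monomial {z : ℂ} (hz : z ∈ Metric.ball (0 : ℂ) 1) (k : ℕ) :
    (monomial w k).eval z = z ^ k := by
  rw [← evalCLM_apply hz]
  refine (hasSum_eval hz _).unique ?_
  have : (fun n => (monomial w k).coeff n * z ^ n) = fun n => if n = k then z ^ k else 0 := by
    funext n
    rw [coeff_monomial]
    split_ifs with h <;> simp [h]
  rw [this]
  exact hasSum_ite_eq k _

theorem hasFPowerSeriesOnBall_eval (f : HardySpace w) :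
    HasFPowerSeriesOnBall f.eval (FormalMultilinearSeries.ofScalars ℂ f.coeff) 0 1 where
  r_le := by
    refine ENNReal.le_of_forall_nnreal_lt fun r hr => ?_
    have hr1 : r < 1 := by exact_mod_cast hr
    refine FormalMultilinearSeries.le_radius_of_tendsto _ (l := 0) ?_
    have hz : ((r : ℝ) : ℂ) ∈ Metric.ball (0 : ℂ) 1 := by
      simpa using hr1
    have := (hasSum_eval hz f).summable.tendsto_atTop_zero.norm
    simpa [FormalMultilinearSeries.ofScalars_norm] using this
  r_pos := one_pos
  hasSum := fun {y} hy => by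
    have hy' : y ∈ Metric.ball (0 : ℂ) 1 := by
      simpa [← ENNReal.ofReal_one, Metric.eball_ofReal] using hy
    have := hasSum_eval hy' f
    rw [evalCLM_apply] at this
    simpa [FormalMultilinearSeries.ofScalars_apply_eq, mul_comm] using this

theorem analyticOnNhd_eval (f : HardySpace w) : AnalyticOnNhd ℂ f.eval (Metric.ball 0 1) := by
  have := (hasFPowerSeriesOnBall_eval f).analyticOnNhd
  simpa [← ENNReal.ofReal_one, Metric.eball_ofReal] using this

end HardySpace

/-! ### The commutant of `M_z`, and intertwiners as weighted composition operators -/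

section Commutant

variable {w : WeightSeq}

theorem mulZ_spec (w : WeightSeq) (g : HardySpace w) {z : ℂ} (hz : z ∈ Metric.ball (0 : ℂ) 1) :
    (mulZ w g).eval z = z * g.eval z :=
  mulOp_spec w (HolClosedDisc.subset_HInfty w id_mem_HolClosedDisc) g z hz

theorem mulZ_pow_eq_shiftFun (k : ℕ) (g : HardySpace w) : (mulZ w ^ k) g = shiftFun w k g := by
  refine eq_of_eval fun z hz => ?_
  rw [← evalCLM_apply hz (shiftFun w k g), evalCLM_shift, evalCLM_apply]
  induction k with
  | zero => simp
  | succ k ih => rw [pow_succ', mul_apply_eq_comp, mulZ_spec w _ hz, ih]; ring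

theorem mulZ_monomial (k : ℕ) : mulZ w (monomial w k) = monomial w (k + 1) :=
  eq_of_eval fun z hz => by
    rw [mulZ_spec w _ hz, eval_monomial hz, eval_monomial hz, pow_succ']

/-- An eigenvector of the adjoint of `M_z` at a point of the disc is a point evaluation. -/
theorem eq_eval_of_comp_mulZ {L : HardySpace w →L[ℂ] ℂ} {c : ℂ}
    (hc : c ∈ Metric.ball (0 : ℂ) 1) (hL : ∀ f, L (mulZ w f) = c * L f) (f : HardySpace w) :
    L f = L (monomial w 0) * f.eval c := by
  have : L = L (monomial w 0) • evalCLM w hc := by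
    refine clm_ext_monomial fun k => ?_
    rw [smul_apply, evalCLM_apply, eval_monomial hc, smul_eq_mul]
    induction k with
    | zero => simp
    | succ k ih => rw [← mulZ_monomial, hL, ih]; ring
  rw [this]
  simp [evalCLM_apply, eval_monomial hc]

theorem norm_mulZ_pow_le (w : WeightSeq) {q : ℝ} (hq : 1 < q) :
    ∃ C : ℝ, 0 ≤ C ∧ ∀ k (f : HardySpace w), ‖(mulZ w ^ k) f‖ ≤ C * q ^ k * ‖f‖ := by
  obtain ⟨C, hC, h⟩ := beta_growth w hq
  refine ⟨C, hC, fun k f => ?_⟩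
  rw [mulZ_pow_eq_shiftFun]
  exact shift_bound k f (by positivity) fun n => h n k

theorem le_one_of_pow_le {x A C : ℝ} (hA : 0 < A) {q : ℝ} (hq : 1 < q)
    (h : ∀ n : ℕ, x ^ n * A ≤ C * q ^ n) : x ≤ q := by
  by_contra! hx
  have hq0 : 0 < q := by linarith
  have h1 : 1 < x / q := (one_lt_div hq0).2 hx
  obtain ⟨n, hn⟩ := pow_unbounded_of_one_lt (C / A) h1
  have := h n
  rw [div_pow, div_lt_div_iff₀ hA (by positivity)] at hn
  linarith

/-- The spectral radius of `M_z` is at most `1`: for every `q > 1` its `n`-th power has norm at most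
`C q ^ n`, and taking `n`-th roots removes the constant. -/
theorem norm_le_one_of_comp_mulZ {L : HardySpace w →L[ℂ] ℂ} {c : ℂ}
    (hL : ∀ f, L (mulZ w f) = c * L f) {f : HardySpace w} (hf : L f ≠ 0) : ‖c‖ ≤ 1 := by
  refine le_of_forall_gt_imp_ge_of_dense fun q hq => ?_
  obtain ⟨C, hC, h⟩ := norm_mulZ_pow_le w hq
  refine le_one_of_pow_le (norm_pos_iff.2 hf) hq (C := ‖L‖ * (C * ‖f‖)) fun n => ?_
  have e : L ((mulZ w ^ n) f) = c ^ n * L f := by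
    induction n with
    | zero => simp
    | succ n ih => rw [pow_succ', mul_apply_eq_comp, hL, ih]; ring
  calc ‖c‖ ^ n * ‖L f‖ = ‖L ((mulZ w ^ n) f)‖ := by rw [e, norm_mul, norm_pow]
    _ ≤ ‖L‖ * (C * q ^ n * ‖f‖) := (L.le_opNorm _).trans (by gcongr; exact h n f)
    _ = _ := by ring

theorem mem_commutant_iff {S T : HardySpace w →L[ℂ] HardySpace w} :
    S ∈ commutant T ↔ ∀ f, S (T f) = T (S f) := by
  unfold commutant
  rw [Set.mem_centralizer_iff]
  simp only [Set.mem_singleton_iff, forall_eq]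
  constructor
  · intro h f
    exact (congrArg (fun R => R f) h).symm
  · intro h
    ext1 f
    exact (h f).symm

/-- An operator commuting with `M_z` is the multiplication by its value at `1`. -/
theorem isMulOp_of_mem_commutant {T : HardySpace w →L[ℂ] HardySpace w}
    (hT : T ∈ commutant (mulZ w)) : IsMulOp w (T (monomial w 0)).eval T := by
  intro g z hz
  have h := eq_eval_of_comp_mulZ (L := (evalCLM w hz).comp T) hz (fun f => by
    rw [ContinuousLinearMap.comp_apply, ContinuousLinearMap.comp_apply,
      mem_commutant_iff.1 hT, evalCLM_apply, evalCLM_apply, mulZ_spec w _ hz]) g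
  simpa only [ContinuousLinearMap.comp_apply, evalCLM_apply] using h

theorem isMulOp_comp_comm {f g : ℂ → ℂ} {S T : HardySpace w →L[ℂ] HardySpace w}
    (hS : IsMulOp w f S) (hT : IsMulOp w g T) (x : HardySpace w) : S (T x) = T (S x) :=
  eq_of_eval fun z hz => by rw [hS _ z hz, hT _ z hz, hT _ z hz, hS _ z hz]; ring

theorem isMulOp_mulZ (w : WeightSeq) : IsMulOp w (fun z => z) (mulZ w) := fun g _ hz =>
  mulZ_spec w g hz

/-- A bounded invertible operator intertwining `M_z` with `M_ψ` is a weighted composition operator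
with symbol `ψ`, which maps the disc into itself. -/
theorem weighted_comp_of_intertwine {ψ : ℂ → ℂ} (hψ : AnalyticOnNhd ℂ ψ (Metric.ball 0 1))
    {T : HardySpace w →L[ℂ] HardySpace w} (hT : IsMulOp w ψ T) (X : HardySpace w ≃L[ℂ] HardySpace w)
    (hX : ∀ f, X (mulZ w f) = T (X f)) :
    Set.MapsTo ψ (Metric.ball 0 1) (Metric.ball 0 1) ∧
    (∀ z ∈ Metric.ball (0 : ℂ) 1, (X (monomial w 0)).eval z ≠ 0) ∧
    ∀ f, ∀ z ∈ Metric.ball (0 : ℂ) 1,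
      (X f).eval z = (X (monomial w 0)).eval z * f.eval (ψ z) := by
  have hL : ∀ z (hz : z ∈ Metric.ball (0 : ℂ) 1), ∀ f,
      ((evalCLM w hz).comp (X : HardySpace w →L[ℂ] HardySpace w)) (mulZ w f)
        = ψ z * ((evalCLM w hz).comp (X : HardySpace w →L[ℂ] HardySpace w)) f := by
    intro z hz f
    simp only [ContinuousLinearMap.comp_apply, ContinuousLinearEquiv.coe_coe, evalCLM_apply]
    rw [hX, hT _ z hz]
  have hone : ∀ z (hz : z ∈ Metric.ball (0 : ℂ) 1),
      ((evalCLM w hz).comp (X : HardySpace w →L[ℂ] HardySpace w)) (X.symm (monomial w 0)) = 1 := by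
    intro z hz
    simp [evalCLM_apply, eval_monomial hz]
  have hle : Set.MapsTo ψ (Metric.ball 0 1) (Metric.closedBall 0 1) := fun z hz => by
    simpa using norm_le_one_of_comp_mulZ (hL z hz) (by rw [hone z hz]; exact one_ne_zero)
  -- A constant `ψ` would force `M_z = c` on the function `1`; otherwise the image of `ψ` is open
  -- and lies in the interior of the closed disc.
  have hmaps : Set.MapsTo ψ (Metric.ball 0 1) (Metric.ball 0 1) := by
    rcases hψ.is_constant_or_isOpen (convex_ball (0 : ℂ) 1).isPreconnected with ⟨c, hc⟩ | hopen
    · exfalso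
      have h1 : mulZ w (monomial w 0) = c • monomial w 0 := by
        apply X.injective
        rw [hX, map_smul]
        refine eq_of_eval fun z hz => ?_
        rw [hT _ z hz, hc z hz, ← evalCLM_apply hz, ← evalCLM_apply hz, map_smul, smul_eq_mul]
      have := congrArg (fun f => f.coeff 1) h1
      simp [mulZ_monomial, coeff_smul, coeff_monomial] at this
    · have := interior_maximal (Set.mapsTo_iff_image_subset.1 hle)
        (hopen _ subset_rfl Metric.isOpen_ball)
      rw [interior_closedBall _ one_ne_zero] at this
      exact Set.mapsTo_iff_image_subset.2 this
  have hcomp : ∀ f, ∀ z ∈ Metric.ball (0 : ℂ) 1,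
      (X f).eval z = (X (monomial w 0)).eval z * f.eval (ψ z) := fun f z hz => by
    have := eq_eval_of_comp_mulZ (hmaps hz) (hL z hz) f
    simpa only [ContinuousLinearMap.comp_apply, ContinuousLinearEquiv.coe_coe,
      evalCLM_apply] using this
  -- The weight cannot vanish, because the function `1` is in the range of `X`.
  refine ⟨hmaps, fun z hz h0 => ?_, hcomp⟩
  have := hcomp (X.symm (monomial w 0)) z hz
  rw [h0, zero_mul, ContinuousLinearEquiv.apply_symm_apply, eval_monomial hz] at this
  simp at this

/-- `R = X⁻¹ M_z X` commutes with `M_z` because `M_z` commutes with `M_ψ`, so `X⁻¹` is a weighted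
composition operator too. Applying `X X⁻¹ = 1` to `1` shows that the two weights multiply to `1`
along `ψ`; applying it to `z` then gives `φ ∘ ψ = id`. Exchanging roles gives the other composite.
-/
theorem isDiscAut_of_intertwine {ψ : ℂ → ℂ} (hψ : AnalyticOnNhd ℂ ψ (Metric.ball 0 1))
    {T : HardySpace w →L[ℂ] HardySpace w} (hT : IsMulOp w ψ T) (X : HardySpace w ≃L[ℂ] HardySpace w)
    (hX : ∀ f, X (mulZ w f) = T (X f)) : IsDiscAut ψ := by
  obtain ⟨hmaps, hne, hcomp⟩ := weighted_comp_of_intertwine hψ hT X hX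
  let R : HardySpace w →L[ℂ] HardySpace w :=
    (X.symm : HardySpace w →L[ℂ] HardySpace w).comp
      ((mulZ w).comp (X : HardySpace w →L[ℂ] HardySpace w))
  have hR : R ∈ commutant (mulZ w) := mem_commutant_iff.2 fun f => by
    apply X.injective
    simp only [R, ContinuousLinearMap.comp_apply, ContinuousLinearEquiv.coe_coe, hX,
      ContinuousLinearEquiv.apply_symm_apply]
    exact isMulOp_comp_comm (isMulOp_mulZ w) hT _
  have hRm := isMulOp_of_mem_commutant hR
  set φ := (R (monomial w 0)).eval
  obtain ⟨hmaps', hne', hcomp'⟩ := weighted_comp_of_intertwine (analyticOnNhd_eval _) hRm X.symm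
    fun f => by simp [R]
  have hz1 : ∀ z ∈ Metric.ball (0 : ℂ) 1, (monomial w 1).eval z = z := fun z hz => by
    rw [eval_monomial hz, pow_one]
  have inv : ∀ (Y : HardySpace w ≃L[ℂ] HardySpace w) (a b : ℂ → ℂ),
      Set.MapsTo a (Metric.ball 0 1) (Metric.ball 0 1) →
      Set.MapsTo b (Metric.ball 0 1) (Metric.ball 0 1) →
      (∀ f, ∀ z ∈ Metric.ball (0 : ℂ) 1,
        (Y f).eval z = (Y (monomial w 0)).eval z * f.eval (a z)) →
      (∀ f, ∀ z ∈ Metric.ball (0 : ℂ) 1,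
        (Y.symm f).eval z = (Y.symm (monomial w 0)).eval z * f.eval (b z)) →
      ∀ z ∈ Metric.ball (0 : ℂ) 1, b (a z) = z := by
    intro Y a b ha hb hYa hYb z hz
    have h0 := hYa (Y.symm (monomial w 0)) z hz
    have h1 := hYa (Y.symm (monomial w 1)) z hz
    rw [ContinuousLinearEquiv.apply_symm_apply] at h0 h1
    rw [eval_monomial hz, pow_zero] at h0
    rw [hz1 z hz, hYb _ _ (ha hz), hz1 _ (hb (ha hz)), ← mul_assoc, ← h0, one_mul] at h1
    exact h1.symm
  have i1 := inv X ψ φ hmaps hmaps' hcomp hcomp'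
  have i2 := inv X.symm φ ψ hmaps' hmaps hcomp' hcomp
  exact ⟨hψ, Set.InvOn.bijOn ⟨i1, i2⟩ hmaps hmaps'⟩

theorem isDiscAut_of_compBoundedInvertible {ψ : ℂ → ℂ}
    (hψ : AnalyticOnNhd ℂ ψ (Metric.ball 0 1))
    (hmaps : Set.MapsTo ψ (Metric.ball 0 1) (Metric.ball 0 1))
    (h : CompBoundedInvertible w ψ) : IsDiscAut ψ := by
  obtain ⟨X, hX⟩ := h
  refine isDiscAut_of_intertwine hψ
    -- `C_ψ M_z C_ψ⁻¹` is multiplication by `ψ`.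
    (T := (X : HardySpace w →L[ℂ] HardySpace w).comp
      ((mulZ w).comp (X.symm : HardySpace w →L[ℂ] HardySpace w))) (fun g z hz => ?_) X
    fun f => by simp
  simp only [ContinuousLinearMap.comp_apply, ContinuousLinearEquiv.coe_coe]
  rw [hX _ z hz, mulZ_spec w _ (hmaps hz), ← hX _ z hz, ContinuousLinearEquiv.apply_symm_apply]

/-- Conjugation by `X` carries the commutant of `S` onto that of `T` when `X S = T X`. -/
theorem conj_mem_commutant {S T R : HardySpace w →L[ℂ] HardySpace w}
    (X : HardySpace w ≃L[ℂ] HardySpace w) (hX : ∀ f, X (S f) = T (X f)) (hR : R ∈ commutant S) :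
    (X : HardySpace w →L[ℂ] HardySpace w).comp
      (R.comp (X.symm : HardySpace w →L[ℂ] HardySpace w)) ∈ commutant T := by
  rw [mem_commutant_iff] at hR ⊢
  intro f
  have : X.symm (T f) = S (X.symm f) := by
    apply X.injective; rw [hX]; simp
  simp only [ContinuousLinearMap.comp_apply, ContinuousLinearEquiv.coe_coe]
  rw [this, hR, hX]

theorem exists_isDiscAut_of_opSimilar {h₁ h₂ : ℂ → ℂ}
    {S T : HardySpace w →L[ℂ] HardySpace w} (hS : IsMulOp w h₁ S) (hT : IsMulOp w h₂ T)
    (hcT : commutant T = commutant (mulZ w)) (h : OpSimilar S T) :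
    ∃ φ : ℂ → ℂ, IsDiscAut φ ∧ Set.EqOn h₂ (h₁ ∘ φ) (Metric.ball 0 1) := by
  obtain ⟨X, hX⟩ := h
  have hR := conj_mem_commutant X hX (mem_commutant_iff.2 fun f =>
    isMulOp_comp_comm (isMulOp_mulZ w) hS f)
  rw [hcT] at hR
  have hRm := isMulOp_of_mem_commutant hR
  refine ⟨_, isDiscAut_of_intertwine (analyticOnNhd_eval _) hRm X fun f => by simp, ?_⟩
  obtain ⟨hmaps, hne, hcomp⟩ := weighted_comp_of_intertwine (analyticOnNhd_eval _) hRm X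
    fun f => by simp
  intro z hz
  have h1 := hcomp (S (monomial w 0)) z hz
  rw [hX, hT _ z hz, hS _ _ (hmaps hz), eval_monomial (hmaps hz), pow_zero, mul_one,
    mul_comm] at h1
  exact mul_left_cancel₀ (hne z hz) h1

end Commutant

/-! ### Taylor coefficients of powers of `φ_a`, and their evolution in `a` -/

/-- The `k`-th Taylor coefficient at `0` of the `m`-th power of `z ↦ (z + a) / (1 + a z)`. -/
def mobiusCoeff : ℕ → ℕ → ℝ → ℝ
  | 0, 0, _ => 1
  | 0, _ + 1, _ => 0
  | m + 1, 0, a => a * mobiusCoeff m 0 a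
  -- Coefficient of `z ^ (k + 1)` in `(1 + a z) φ_a ^ (m + 1) = (z + a) φ_a ^ m`.
  | m + 1, k + 1, a => -a * mobiusCoeff (m + 1) k a + mobiusCoeff m k a + a * mobiusCoeff m (k + 1) a

/-- The coefficients of `(1 - z²) f'(z)` in terms of those of `f`. -/
def flowGen {R : Type*} [Ring R] (u : ℕ → R) : ℕ → R
  | 0 => u 1
  | k + 1 => (k + 2) * u (k + 2) - k * u k

theorem mobiusCoeff_zero_zero (a : ℝ) : mobiusCoeff 0 0 a = 1 := by rw [mobiusCoeff]

theorem mobiusCoeff_zero_succ (k : ℕ) (a : ℝ) : mobiusCoeff 0 (k + 1) a = 0 := by rw [mobiusCoeff]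

theorem mobiusCoeff_succ_zero (m : ℕ) (a : ℝ) :
    mobiusCoeff (m + 1) 0 a = a * mobiusCoeff m 0 a := by rw [mobiusCoeff]

theorem mobiusCoeff_succ_succ (m k : ℕ) (a : ℝ) : mobiusCoeff (m + 1) (k + 1) a =
    -a * mobiusCoeff (m + 1) k a + mobiusCoeff m k a + a * mobiusCoeff m (k + 1) a := by
  rw [mobiusCoeff]

/-- The transport equation `(1 - a²) ∂_a φ_a ^ m = (1 - z²) ∂_z φ_a ^ m`, valid since `∂_a φ_a = (1
- z²) / (1 + a z)²` and `∂_z φ_a = (1 - a²) / (1 + a z)²`. On coefficients it follows from the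
recursion by induction on `m`, then `k`. -/
theorem hasDerivAt_mobiusCoeff {a : ℝ} (ha : 1 - a ^ 2 ≠ 0) (m k : ℕ) :
    HasDerivAt (mobiusCoeff m k) ((1 - a ^ 2)⁻¹ * flowGen (fun j => mobiusCoeff m j a) k) a := by
  induction m generalizing k with
  | zero =>
    have : flowGen (fun j => mobiusCoeff 0 j a) k = 0 := by
      rcases k with _ | _ | k <;> simp [flowGen, mobiusCoeff_zero_succ]
    rw [this, mul_zero]
    rcases k with _ | k
    · have : mobiusCoeff 0 0 = fun _ => 1 := funext mobiusCoeff_zero_zero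
      rw [this]; exact hasDerivAt_const _ _
    · have : mobiusCoeff 0 (k + 1) = fun _ => 0 := funext (mobiusCoeff_zero_succ k)
      rw [this]; exact hasDerivAt_const _ _
  | succ m ih =>
    induction k with
    | zero =>
      have : mobiusCoeff (m + 1) 0 = fun a => a * mobiusCoeff m 0 a :=
        funext (mobiusCoeff_succ_zero m)
      rw [this]
      convert! (hasDerivAt_id a).mul (ih 0) using 1
      simp only [flowGen, id, mobiusCoeff_succ_succ, mobiusCoeff_succ_zero]
      field_simp
      ring
    | succ k ihk =>
      have : mobiusCoeff (m + 1) (k + 1) = fun a => -a * mobiusCoeff (m + 1) k a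
          + mobiusCoeff m k a + a * mobiusCoeff m (k + 1) a := funext (mobiusCoeff_succ_succ m k)
      rw [this]
      convert! (((hasDerivAt_neg a).mul ihk).add (ih k)).add
        ((hasDerivAt_id a).mul (ih (k + 1))) using 1
      rcases k with _ | k
      · have e1 := mobiusCoeff_succ_zero m a
        have e2 := mobiusCoeff_succ_succ m 0 a
        have e3 := mobiusCoeff_succ_succ m 1 a
        simp only [flowGen, id, zero_add, Nat.reduceAdd, CharP.cast_eq_zero] at *
        field_simp
        rw [e3, e2, e1]
        ring
      · have e1 := mobiusCoeff_succ_succ m k a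
        have e2 := mobiusCoeff_succ_succ m (k + 1) a
        have e3 := mobiusCoeff_succ_succ m (k + 2) a
        simp only [flowGen, id, Nat.cast_add, Nat.cast_one] at *
        field_simp
        simp only [show k + 1 + 1 = k + 2 from rfl, show k + 1 + 2 = k + 3 from rfl] at *
        linear_combination ((k : ℝ) + 3) * e3 - a * e2 - k * e1

/-- The pole `-1 / a` of `φ_a` has modulus at least `1 / s > 1 / r`, so the coefficients decay
geometrically, uniformly in `a ≤ s`. -/
theorem exists_abs_mobiusCoeff_le {s r : ℝ} (hs : 0 ≤ s) (hsr : s < r) (m : ℕ) :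
    ∃ C : ℝ, 0 ≤ C ∧ ∀ k, ∀ a ∈ Set.Icc 0 s, |mobiusCoeff m k a| ≤ C * r ^ k := by
  have hr : 0 < r := hs.trans_lt hsr
  induction m with
  | zero =>
    refine ⟨1, zero_le_one, fun k a _ => ?_⟩
    rcases k with _ | k
    · simp [mobiusCoeff_zero_zero]
    · rw [mobiusCoeff_zero_succ, abs_zero]; positivity
  | succ m ih =>
    obtain ⟨C, hC, h⟩ := ih
    have hd : 0 < r - s := by linarith
    -- The constant must satisfy `s B + C + s C r ≤ B r`, so that the recursion closes, and `s C ≤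
    -- B`, for the coefficient at `0`.
    refine ⟨C * (1 + r * s + s) / (r - s) + s * C, by positivity, fun k a ha => ?_⟩
    set B := C * (1 + r * s + s) / (r - s) + s * C
    have hB : s * B + C + s * C * r ≤ B * r := by
      have : B * (r - s) = C * (1 + r * s + s) + s * C * (r - s) := by
        simp only [B]; field_simp
      nlinarith [mul_nonneg hs hC, mul_nonneg (mul_nonneg hs hC) hd.le]
    obtain ⟨ha0, has⟩ := ha
    induction k with
    | zero =>
      rw [mobiusCoeff_succ_zero, abs_mul, abs_of_nonneg ha0, pow_zero, mul_one]
      have h0 := h 0 a ⟨ha0, has⟩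
      rw [pow_zero, mul_one] at h0
      have : 0 ≤ C * (1 + r * s + s) / (r - s) := by positivity
      calc a * |mobiusCoeff m 0 a| ≤ s * C := by gcongr
        _ ≤ B := by simp only [B]; linarith
    | succ k ihk =>
      rw [mobiusCoeff_succ_succ]
      have h0 := h k a ⟨ha0, has⟩
      have h1 := h (k + 1) a ⟨ha0, has⟩
      have hB0 : 0 ≤ B := by positivity
      calc |-a * mobiusCoeff (m + 1) k a + mobiusCoeff m k a + a * mobiusCoeff m (k + 1) a|
          ≤ a * |mobiusCoeff (m + 1) k a| + |mobiusCoeff m k a| + a * |mobiusCoeff m (k + 1) a| := by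
            refine (abs_add_three _ _ _).trans (le_of_eq ?_)
            rw [abs_mul, abs_mul, abs_neg, abs_of_nonneg ha0]
        _ ≤ s * (B * r ^ k) + C * r ^ k + s * (C * r ^ (k + 1)) := by gcongr
        _ = (s * B + C + s * C * r) * r ^ k := by ring
        _ ≤ B * r * r ^ k := by gcongr
        _ = B * r ^ (k + 1) := by ring

theorem hasSum_mobiusCoeff {a : ℝ} (ha0 : 0 ≤ a) (ha1 : a < 1) {z : ℂ}
    (hz : z ∈ Metric.ball (0 : ℂ) 1) (m : ℕ) :
    HasSum (fun k => (mobiusCoeff m k a : ℂ) * z ^ k) (((z + a) / (1 + a * z)) ^ m) := by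
  have hz1 : ‖z‖ < 1 := by simpa using hz
  obtain ⟨r, hr, hr1⟩ := exists_between ha1
  have hsum : ∀ m, Summable fun k => (mobiusCoeff m k a : ℂ) * z ^ k := by
    intro m
    obtain ⟨C, hC, h⟩ := exists_abs_mobiusCoeff_le ha0 hr m
    refine Summable.of_norm_bounded ((summable_geometric_of_lt_one (by linarith) hr1).mul_left C)
      fun k => ?_
    rw [norm_mul, norm_pow, Complex.norm_real, Real.norm_eq_abs]
    calc |mobiusCoeff m k a| * ‖z‖ ^ k ≤ C * r ^ k * 1 := by
          refine mul_le_mul (h k a ⟨ha0, le_rfl⟩) (pow_le_one₀ (norm_nonneg _) hz1.le)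
            (by positivity) (mul_nonneg hC (pow_nonneg (by linarith) _))
      _ = _ := mul_one _
  have hne : 1 + (a : ℂ) * z ≠ 0 := by
    intro h
    have : ‖(a : ℂ) * z‖ = 1 := by
      rw [eq_neg_of_add_eq_zero_right h, norm_neg, norm_one]
    rw [norm_mul, Complex.norm_real, Real.norm_eq_abs, abs_of_nonneg ha0] at this
    nlinarith [norm_nonneg z]
  induction m with
  | zero =>
    rw [pow_zero]
    convert! hasSum_ite_eq (0 : ℕ) (1 : ℂ) using 1
    funext k
    rcases k with _ | k
    · simp [mobiusCoeff_zero_zero]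
    · simp [mobiusCoeff_zero_succ]
  | succ m ih =>
    obtain ⟨t, ht⟩ := hsum (m + 1)
    have h1 := (hasSum_nat_add_iff' 1).2 ht
    have h2 := (hasSum_nat_add_iff' 1).2 ih
    have h3 := ((ht.mul_left (-a * z)).add (ih.mul_left z)).add (h2.mul_left (a : ℂ))
    have := h1.unique (h3.congr_fun fun k => ?_)
    · simp only [Finset.range_one, Finset.sum_singleton, pow_zero, mul_one,
        mobiusCoeff_succ_zero] at this
      push_cast at this
      have e : (1 + a * z) * t = (z + a) * ((z + a) / (1 + a * z)) ^ m := by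
        linear_combination this
      rw [pow_succ, mul_div_assoc', mul_comm _ (z + a : ℂ), ← e, mul_div_cancel_left₀ _ hne]
      exact ht
    · rw [mobiusCoeff_succ_succ]
      push_cast
      ring

/-! ### The energy estimate in the weighted norm -/

theorem inner_flowGen_succ (y : ℂ) (x : ℕ → ℂ) (k : ℕ) : inner ℝ y (flowGen x (k + 1)) =
    ((k : ℝ) + 2) * inner ℝ y (x (k + 2)) - k * inner ℝ y (x k) := by
  simp [flowGen, Complex.inner]
  ring

/-- Summation by parts for the quadratic form of `(1 - z²) d/dz` in a weighted `ℓ²`. -/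
theorem sum_inner_flowGen (b : ℕ → ℝ) (x : ℕ → ℂ) (N : ℕ) :
    ∑ k ∈ Finset.range (N + 1), b k * inner ℝ (x k) (flowGen x k) =
      ∑ k ∈ Finset.range N, (((k : ℝ) + 1) * b k - k * b (k + 1)) * inner ℝ (x k) (x (k + 1))
        + b N * ((N : ℝ) + 1) * inner ℝ (x N) (x (N + 1)) := by
  induction N with
  | zero => simp [flowGen]
  | succ N ih =>
    rw [Finset.sum_range_succ, ih, Finset.sum_range_succ, inner_flowGen_succ,
      real_inner_comm (x N) (x (N + 1))]
    push_cast
    ring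

namespace WeightSeq

/-- With `v = w_{k+1}` the left side is `β_k² |1 - k (v - 1)(1 + v)|`, and polynomial growth bounds
`k |v - 1|`. A bound on `1 / v` turns `β_k²` into `β_k β_{k+1}`, the form suited to pairing
neighbouring coefficients. -/
theorem PolynomialGrowth.exists_abs_le {w : WeightSeq} (hw : w.PolynomialGrowth) :
    ∃ K : ℝ, 0 ≤ K ∧ ∀ k : ℕ,
      |((k : ℝ) + 1) * w.beta k ^ 2 - k * w.beta (k + 1) ^ 2| ≤ K * (w.beta k * w.beta (k + 1)) := by
  obtain ⟨K, hK⟩ := hw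
  have ht := (tendsto_add_atTop_iff_nat 1).2 w.tendsto_one
  obtain ⟨A, hA⟩ := ht.bddAbove_range
  obtain ⟨B, hB⟩ := (ht.inv₀ one_ne_zero).bddAbove_range
  have hA' : ∀ k, w.w (k + 1) ≤ A := fun k => hA ⟨k, rfl⟩
  have hB' : ∀ k, (w.w (k + 1))⁻¹ ≤ B := fun k => hB ⟨k, rfl⟩
  have hA0 : 0 < A := (w.pos 1 le_rfl).trans_le (hA' 0)
  have hB0 : 0 < B := (inv_pos.2 (w.pos 1 le_rfl)).trans_le (hB' 0)
  have hK0 : 0 ≤ K := le_trans (by positivity) (hK 1 le_rfl)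
  refine ⟨(1 + K * (1 + A)) * B, by positivity, fun k => ?_⟩
  have hb := w.beta_pos k
  have hp := w.pos (k + 1) (by omega)
  have h1 : (k : ℝ) * |w.w (k + 1) - 1| ≤ K := by
    refine le_trans ?_ (hK (k + 1) (by omega))
    push_cast
    gcongr
    linarith
  rw [w.beta_succ]
  set v := w.w (k + 1)
  have e : ((k : ℝ) + 1) * w.beta k ^ 2 - k * (w.beta k * v) ^ 2
      = w.beta k ^ 2 * (1 - k * (v - 1) * (1 + v)) := by ring
  have h2 : |1 - k * (v - 1) * (1 + v)| ≤ 1 + K * (1 + A) := by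
    refine (abs_sub _ _).trans ?_
    rw [abs_one, abs_mul, abs_mul, Nat.abs_cast, abs_of_pos (by linarith : 0 < 1 + v)]
    gcongr
    exact hA' k
  rw [e, abs_mul, abs_of_pos (by positivity : 0 < w.beta k ^ 2)]
  have h3 : 1 ≤ B * v := by
    have := hB' k
    rwa [inv_le_iff_one_le_mul₀ hp] at this
  calc w.beta k ^ 2 * |1 - k * (v - 1) * (1 + v)|
      ≤ w.beta k ^ 2 * ((1 + K * (1 + A)) * 1) := by rw [mul_one]; gcongr
    _ ≤ w.beta k ^ 2 * ((1 + K * (1 + A)) * (B * v)) := by gcongr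
    _ = _ := by ring

/-- The real part of the quadratic form of the unbounded generator is controlled by the norm:
summation by parts leaves only products of neighbouring coefficients, handled by Cauchy–Schwarz, and
a boundary term from truncating at `N`. -/
theorem PolynomialGrowth.exists_abs_sum_inner_flowGen_le {w : WeightSeq}
    (hw : w.PolynomialGrowth) : ∃ K : ℝ, 0 ≤ K ∧ ∀ (x : ℕ → ℂ) (N : ℕ),
      |∑ k ∈ Finset.range (N + 1), w.beta k ^ 2 * (2 * inner ℝ (x k) (flowGen x k))| ≤
        K * ∑ k ∈ Finset.range (N + 1), w.beta k ^ 2 * ‖x k‖ ^ 2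
          + 2 * (w.beta N ^ 2 * ((N : ℝ) + 1) * (‖x N‖ * ‖x (N + 1)‖)) := by
  obtain ⟨K, hK, h⟩ := hw.exists_abs_le
  refine ⟨2 * K, by positivity, fun x N => ?_⟩
  have hterm : ∀ k : ℕ, |2 * ((((k : ℝ) + 1) * w.beta k ^ 2 - k * w.beta (k + 1) ^ 2)
      * inner ℝ (x k) (x (k + 1)))|
      ≤ K * (w.beta k ^ 2 * ‖x k‖ ^ 2 + w.beta (k + 1) ^ 2 * ‖x (k + 1)‖ ^ 2) := by
    intro k
    have hb := w.beta_pos k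
    have hb' := w.beta_pos (k + 1)
    rw [abs_mul, abs_mul, abs_two]
    calc 2 * (|((k : ℝ) + 1) * w.beta k ^ 2 - k * w.beta (k + 1) ^ 2| * |inner ℝ (x k) (x (k + 1))|)
        ≤ 2 * (K * (w.beta k * w.beta (k + 1)) * (‖x k‖ * ‖x (k + 1)‖)) := by
          gcongr
          · exact h k
          · exact abs_real_inner_le_norm _ _
      _ = K * (2 * (w.beta k * ‖x k‖) * (w.beta (k + 1) * ‖x (k + 1)‖)) := by ring
      _ ≤ K * ((w.beta k * ‖x k‖) ^ 2 + (w.beta (k + 1) * ‖x (k + 1)‖) ^ 2) := by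
          gcongr; exact two_mul_le_add_sq _ _
      _ = _ := by ring
  have e : ∑ k ∈ Finset.range (N + 1), w.beta k ^ 2 * (2 * inner ℝ (x k) (flowGen x k)) =
      ∑ k ∈ Finset.range N, 2 * ((((k : ℝ) + 1) * w.beta k ^ 2 - k * w.beta (k + 1) ^ 2)
        * inner ℝ (x k) (x (k + 1)))
      + 2 * (w.beta N ^ 2 * ((N : ℝ) + 1) * inner ℝ (x N) (x (N + 1))) := by
    rw [← Finset.mul_sum, ← mul_add, ← sum_inner_flowGen (fun k => w.beta k ^ 2), Finset.mul_sum]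
    exact Finset.sum_congr rfl fun k _ => by ring
  rw [e]
  refine (abs_add_le _ _).trans (add_le_add ?_ ?_)
  · refine (Finset.abs_sum_le_sum_abs _ _).trans ((Finset.sum_le_sum fun k _ => hterm k).trans ?_)
    rw [← Finset.mul_sum, Finset.sum_add_distrib]
    have h1 := Finset.sum_range_succ (fun k => w.beta k ^ 2 * ‖x k‖ ^ 2) N
    have h2 := Finset.sum_range_succ' (fun k => w.beta k ^ 2 * ‖x k‖ ^ 2) N
    have h3 : 0 ≤ w.beta N ^ 2 * ‖x N‖ ^ 2 := by positivity
    have h4 : 0 ≤ w.beta 0 ^ 2 * ‖x 0‖ ^ 2 := by positivity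
    nlinarith
  · rw [abs_mul, abs_two, abs_mul, abs_of_nonneg (by positivity : 0 ≤ w.beta N ^ 2 * ((N : ℝ) + 1))]
    gcongr
    exact abs_real_inner_le_norm _ _

end WeightSeq

/-- The `k`-th Taylor coefficient of `p ((z + a) / (1 + a z))` for a polynomial `p`. -/
def compCoeff (p : ℕ →₀ ℂ) (k : ℕ) (a : ℝ) : ℂ := p.sum fun m x => x * (mobiusCoeff m k a : ℂ)

theorem mobiusCoeff_at_zero (m k : ℕ) : mobiusCoeff m k 0 = if k = m then 1 else 0 := by
  induction m generalizing k with
  | zero =>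
    rcases k with _ | k
    · simp [mobiusCoeff_zero_zero]
    · simp [mobiusCoeff_zero_succ]
  | succ m ih =>
    rcases k with _ | k
    · simp [mobiusCoeff_succ_zero]
    · simp [mobiusCoeff_succ_succ, ih]

theorem compCoeff_zero (p : ℕ →₀ ℂ) (k : ℕ) : compCoeff p k 0 = p k := by
  simp only [compCoeff, mobiusCoeff_at_zero, Finsupp.sum, apply_ite Complex.ofReal]
  simp [eq_comm]

theorem flowGen_sum {R ι : Type*} [CommRing R] (s : Finset ι) (c : ι → R) (u : ι → ℕ → R) (k : ℕ) :
    flowGen (fun j => ∑ i ∈ s, c i * u i j) k = ∑ i ∈ s, c i * flowGen (u i) k := by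
  rcases k with _ | k
  · rfl
  · simp only [flowGen, Finset.mul_sum, ← Finset.sum_sub_distrib]
    exact Finset.sum_congr rfl fun i _ => by ring

theorem flowGen_ofReal (u : ℕ → ℝ) (k : ℕ) :
    ((flowGen u k : ℝ) : ℂ) = flowGen (fun j => (u j : ℂ)) k := by
  rcases k with _ | k
  · rfl
  · simp [flowGen]

theorem hasDerivAt_compCoeff {a : ℝ} (ha : 1 - a ^ 2 ≠ 0) (p : ℕ →₀ ℂ) (k : ℕ) :
    HasDerivAt (compCoeff p k) ((1 - a ^ 2)⁻¹ • flowGen (fun j => compCoeff p j a) k) a := by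
  have h : HasDerivAt (fun a => ∑ m ∈ p.support, p m * (mobiusCoeff m k a : ℂ))
      (∑ m ∈ p.support, p m * (((1 - a ^ 2)⁻¹ * flowGen (fun j => mobiusCoeff m j a) k : ℝ) : ℂ))
      a := HasDerivAt.fun_sum fun m _ => (hasDerivAt_mobiusCoeff ha m k).ofReal_comp.const_mul _
  convert! h using 1
  simp only [compCoeff, Finsupp.sum, flowGen_sum, ← flowGen_ofReal]
  rw [Finset.smul_sum]
  refine Finset.sum_congr rfl fun m _ => ?_
  rw [Complex.real_smul]
  push_cast
  ring

theorem exists_norm_compCoeff_le {s r : ℝ} (hs : 0 ≤ s) (hsr : s < r) (p : ℕ →₀ ℂ) :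
    ∃ C : ℝ, 0 ≤ C ∧ ∀ k, ∀ a ∈ Set.Icc 0 s, ‖compCoeff p k a‖ ≤ C * r ^ k := by
  choose C hC h using exists_abs_mobiusCoeff_le hs hsr
  refine ⟨∑ m ∈ p.support, ‖p m‖ * C m, Finset.sum_nonneg fun m _ =>
    mul_nonneg (norm_nonneg _) (hC m), fun k a ha => ?_⟩
  rw [Finset.sum_mul]
  refine norm_sum_le_of_le _ fun m _ => ?_
  rw [norm_mul, Complex.norm_real, Real.norm_eq_abs, mul_assoc]
  gcongr
  exact h m k a ha

/-- The energy estimate along the hyperbolic flow. -/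
theorem WeightSeq.PolynomialGrowth.exists_sum_compCoeff_le {w : WeightSeq}
    (hw : w.PolynomialGrowth) {s : ℝ} (hs : 0 ≤ s) (hs1 : s < 1) :
    ∃ A : ℝ, 0 ≤ A ∧ ∀ (p : ℕ →₀ ℂ) (δ : ℝ),
      (∀ N, ∑ k ∈ Finset.range N, w.beta k ^ 2 * ‖p k‖ ^ 2 ≤ δ) →
      ∀ N, ∑ k ∈ Finset.range N, w.beta k ^ 2 * ‖compCoeff p k s‖ ^ 2 ≤ δ * A := by
  obtain ⟨K, hK, hflow⟩ := hw.exists_abs_sum_inner_flowGen_le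
  have hs2 : 0 < 1 - s ^ 2 := by nlinarith
  refine ⟨Real.exp ((1 - s ^ 2)⁻¹ * K * s), (Real.exp_pos _).le, fun p δ hδ M => ?_⟩
  -- Here `r` is a decay rate of the coefficients and `q` a growth rate of the weights; `q r < 1`
  -- makes the boundary term `ε N` vanish as `N → ∞`.
  obtain ⟨r, hsr, hr1⟩ := exists_between hs1
  have hr : 0 < r := hs.trans_lt hsr
  obtain ⟨q, hq1, hq⟩ := exists_between ((one_lt_inv₀ hr).2 hr1)
  have hqr : q * r < 1 := by rwa [lt_inv_comm₀ (by linarith) hr, ← one_div,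
    lt_div_iff₀ (by linarith), mul_comm] at hq
  obtain ⟨B, hB, hβ⟩ := beta_growth w hq1
  obtain ⟨C, hC, hc⟩ := exists_norm_compCoeff_le hs hsr p
  let ε : ℕ → ℝ := fun N => (1 - s ^ 2)⁻¹ *
    (2 * (B ^ 2 * C ^ 2 * r * (((N : ℝ) + 1) * ((q * r) ^ 2) ^ N)))
  have hε : Tendsto ε atTop (𝓝 0) := by
    have hρ : (q * r) ^ 2 < 1 := pow_lt_one₀ (by positivity) hqr two_ne_zero
    have h1 := (tendsto_self_mul_const_pow_of_lt_one (by positivity) hρ).add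
      (tendsto_pow_atTop_nhds_zero_of_lt_one (by positivity) hρ)
    have h2 := (((h1.const_mul (B ^ 2 * C ^ 2 * r)).const_mul 2).const_mul (1 - s ^ 2)⁻¹)
    simp only [add_zero, mul_zero] at h2
    refine h2.congr fun N => ?_
    simp only [ε]
    ring
  have hbound : ∀ N, ∑ k ∈ Finset.range (N + 1), w.beta k ^ 2 * ‖compCoeff p k s‖ ^ 2 ≤
      gronwallBound δ ((1 - s ^ 2)⁻¹ * K) (ε N) s := by
    intro N
    -- Truncating the energy makes it a finite sum, so it can be differentiated term by term; the
    -- price is the error `ε N` in Gronwall's inequality.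
    let F : ℝ → ℝ := fun a => ∑ k ∈ Finset.range (N + 1), w.beta k ^ 2 * ‖compCoeff p k a‖ ^ 2
    have hF0 : ∀ a, 0 ≤ F a := fun a => Finset.sum_nonneg fun k _ => by positivity
    have hne : ∀ a ∈ Set.Icc 0 s, 1 - s ^ 2 ≤ 1 - a ^ 2 := fun a ha => by
      have := pow_le_pow_left₀ ha.1 ha.2 2
      linarith
    have hF : ∀ a ∈ Set.Icc 0 s, HasDerivAt F ((1 - a ^ 2)⁻¹ * ∑ k ∈ Finset.range (N + 1),
        w.beta k ^ 2 * (2 * inner ℝ (compCoeff p k a) (flowGen (fun j => compCoeff p j a) k))) a := by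
      intro a ha
      have ha' : 1 - a ^ 2 ≠ 0 := (hs2.trans_le (hne a ha)).ne'
      have := HasDerivAt.fun_sum (u := Finset.range (N + 1)) fun k _ =>
        (hasDerivAt_compCoeff ha' p k).norm_sq.const_mul (w.beta k ^ 2)
      convert! this using 1
      rw [Finset.mul_sum]
      refine Finset.sum_congr rfl fun k _ => ?_
      rw [real_inner_smul_right]
      ring
    have hg := norm_le_gronwallBound_of_norm_deriv_right_le (f := F) (δ := δ)
      (K := (1 - s ^ 2)⁻¹ * K) (ε := ε N) (a := 0) (b := s)
      (fun a ha => (hF a ha).continuousAt.continuousWithinAt)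
      (fun a ha => (hF a (Set.Ico_subset_Icc_self ha)).hasDerivWithinAt) ?_ ?_ s ⟨hs, le_rfl⟩
    · rwa [Real.norm_of_nonneg (hF0 s), sub_zero] at hg
    · rw [Real.norm_of_nonneg (hF0 0)]
      simp only [F, compCoeff_zero]
      exact hδ _
    · intro a ha
      have ha := Set.Ico_subset_Icc_self ha
      have h1 := hne a ha
      rw [norm_mul, Real.norm_eq_abs, Real.norm_eq_abs, Real.norm_of_nonneg (hF0 a),
        abs_of_pos (inv_pos.2 (hs2.trans_le h1))]
      have hβN : w.beta N ≤ B * q ^ N := by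
        simpa [WeightSeq.beta] using hβ 0 N
      have hb := w.beta_pos N
      have hq0 : 0 < q := by linarith
      calc _ ≤ (1 - s ^ 2)⁻¹ * (K * F a + 2 * (w.beta N ^ 2 * ((N : ℝ) + 1) *
              (‖compCoeff p N a‖ * ‖compCoeff p (N + 1) a‖))) := by
            gcongr
            exact hflow _ N
        _ ≤ (1 - s ^ 2)⁻¹ * (K * F a + 2 * ((B * q ^ N) ^ 2 * ((N : ℝ) + 1) *
              ((C * r ^ N) * (C * r ^ (N + 1))))) := by
            gcongr
            · exact hc N a ha
            · exact hc (N + 1) a ha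
        _ = _ := by simp only [ε]; ring
  have hlim := ((gronwallBound_continuous_ε δ ((1 - s ^ 2)⁻¹ * K) s).tendsto 0).comp hε
  rw [gronwallBound_ε0] at hlim
  refine ge_of_tendsto hlim ?_
  filter_upwards [eventually_ge_atTop M] with N hN
  refine le_trans ?_ (hbound N)
  exact Finset.sum_le_sum_of_subset_of_nonneg (Finset.range_mono (by omega))
    fun k _ _ => by positivity

/-! ### Bounded composition operators, and the case of `φ_a` -/

/-- `f ↦ f ∘ φ` is bounded on `H²_β`. -/
def CompBounded (w : WeightSeq) (φ : ℂ → ℂ) : Prop :=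
  ∃ T : HardySpace w →L[ℂ] HardySpace w,
    ∀ f : HardySpace w, ∀ z ∈ Metric.ball (0 : ℂ) 1, (T f).eval z = f.eval (φ z)

theorem CompBounded.comp {w : WeightSeq} {φ ψ : ℂ → ℂ} (hφ : CompBounded w φ)
    (hψ : CompBounded w ψ) (hm : Set.MapsTo ψ (Metric.ball 0 1) (Metric.ball 0 1)) :
    CompBounded w (φ ∘ ψ) := by
  obtain ⟨S, hS⟩ := hφ
  obtain ⟨T, hT⟩ := hψ
  exact ⟨T.comp S, fun f z hz => by
    rw [ContinuousLinearMap.comp_apply, hT _ z hz, hS _ _ (hm hz), Function.comp_apply]⟩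

theorem CompBounded.congr {w : WeightSeq} {φ ψ : ℂ → ℂ} (hφ : CompBounded w φ)
    (h : Set.EqOn φ ψ (Metric.ball 0 1)) : CompBounded w ψ := by
  obtain ⟨T, hT⟩ := hφ
  exact ⟨T, fun f z hz => by rw [hT f z hz, h hz]⟩

/-- A composition operator is bounded as soon as it is bounded on polynomials. -/
theorem compBounded_of_monomial {w : WeightSeq} {φ : ℂ → ℂ}
    (hφ : Set.MapsTo φ (Metric.ball 0 1) (Metric.ball 0 1)) (U : ℕ → HardySpace w)
    (hU : ∀ m, ∀ z ∈ Metric.ball (0 : ℂ) 1, (U m).eval z = φ z ^ m) (A : ℝ)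
    (hA : ∀ p : ℕ →₀ ℂ, ‖Finsupp.linearCombination ℂ U p‖ ≤
      A * ‖Finsupp.linearCombination ℂ (monomial w) p‖) : CompBounded w φ := by
  have hd : DenseRange (Finsupp.linearCombination ℂ (monomial w)) := by
    intro f
    refine mem_closure_of_tendsto (hasSum_monomial f) (Eventually.of_forall fun s => ?_)
    refine ⟨∑ k ∈ s, Finsupp.single k (f.coeff k), ?_⟩
    rw [map_sum]
    simp [Finsupp.linearCombination_single]
  let T := (Finsupp.linearCombination ℂ U).extendOfNorm (Finsupp.linearCombination ℂ (monomial w))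
  have hT : ∀ m, T (monomial w m) = U m := fun m => by
    have := (Finsupp.linearCombination ℂ U).extendOfNorm_eq hd ⟨A, hA⟩ (Finsupp.single m 1)
    simpa [Finsupp.linearCombination_single] using this
  refine ⟨T, fun f z hz => ?_⟩
  have : (evalCLM w hz).comp T = evalCLM w (hφ hz) := clm_ext_monomial fun m => by
    rw [ContinuousLinearMap.comp_apply, hT, evalCLM_apply, evalCLM_apply, hU m z hz,
      eval_monomial (hφ hz)]
  rw [← evalCLM_apply hz, ← evalCLM_apply (hφ hz), ← this]
  rfl

theorem HardySpace.coeff_linearCombination {w : WeightSeq} (U : ℕ → HardySpace w) (p : ℕ →₀ ℂ)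
    (k : ℕ) : (Finsupp.linearCombination ℂ U p).coeff k = p.sum fun m x => x * (U m).coeff k := by
  let c : HardySpace w →ₗ[ℂ] ℂ :=
    { toFun := fun f => f.coeff k
      map_add' := fun f g => coeff_add f g k
      map_smul' := fun x f => coeff_smul x f k }
  change c (Finsupp.linearCombination ℂ U p) = _
  rw [Finsupp.linearCombination_apply, map_finsuppSum]
  simp only [map_smul, smul_eq_mul]
  rfl

theorem HardySpace.sum_le_norm_sq {w : WeightSeq} (f : HardySpace w) (N : ℕ) :
    ∑ k ∈ Finset.range N, w.beta k ^ 2 * ‖f.coeff k‖ ^ 2 ≤ ‖f‖ ^ 2 := by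
  rw [norm_sq_eq]
  simp only [mul_comm (w.beta _ ^ 2)]
  exact f.2.sum_le_tsum _ fun k _ => by positivity

/-- The hyperbolic Möbius map `z ↦ (z + a) / (1 + a z)`. -/
def mobius (a : ℝ) (z : ℂ) : ℂ := (z + a) / (1 + a * z)

theorem mobius_denom_ne {a : ℝ} (ha : |a| < 1) {z : ℂ} (hz : z ∈ Metric.ball (0 : ℂ) 1) :
    1 + (a : ℂ) * z ≠ 0 := by
  intro h
  have hz1 : ‖z‖ < 1 := by simpa using hz
  have : ‖(a : ℂ) * z‖ = 1 := by rw [eq_neg_of_add_eq_zero_right h, norm_neg, norm_one]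
  rw [norm_mul, Complex.norm_real, Real.norm_eq_abs] at this
  nlinarith [norm_nonneg z, abs_nonneg a]

theorem mapsTo_mobius {a : ℝ} (ha : |a| < 1) :
    Set.MapsTo (mobius a) (Metric.ball 0 1) (Metric.ball 0 1) := by
  intro z hz
  have hne := mobius_denom_ne ha hz
  have hz1 : ‖z‖ < 1 := by simpa using hz
  rw [mem_ball_zero_iff, mobius, norm_div, div_lt_one (norm_pos_iff.2 hne)]
  refine lt_of_pow_lt_pow_left₀ 2 (norm_nonneg _) ?_
  have ha2 : a ^ 2 < 1 := by rwa [sq_lt_one_iff_abs_lt_one]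
  have hz2 : z.re * z.re + z.im * z.im < 1 := by
    rw [← Complex.normSq_apply, Complex.normSq_eq_norm_sq]
    nlinarith [norm_nonneg z]
  -- This is `|1 + a z|² - |z + a|² = (1 - a²)(1 - |z|²) > 0`.
  rw [← Complex.normSq_eq_norm_sq, ← Complex.normSq_eq_norm_sq, Complex.normSq_apply,
    Complex.normSq_apply]
  simp
  nlinarith [mul_pos (sub_pos.2 ha2) (sub_pos.2 hz2)]

theorem mobius_neg_mobius {a : ℝ} (ha : |a| < 1) {z : ℂ} (hz : z ∈ Metric.ball (0 : ℂ) 1) :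
    mobius (-a) (mobius a z) = z := by
  have h1 := mobius_denom_ne ha hz
  have h2 := mobius_denom_ne (a := -a) (by rwa [abs_neg]) (mapsTo_mobius ha hz)
  rw [mobius, div_eq_iff h2]
  have hv : mobius a z * (1 + a * z) = z + a := div_mul_cancel₀ _ h1
  push_cast
  linear_combination hv

theorem isDiscAut_mobius {a : ℝ} (ha : |a| < 1) : IsDiscAut (mobius a) := by
  have ha' : |-a| < 1 := by rwa [abs_neg]
  refine ⟨fun z hz => ?_, Set.InvOn.bijOn (f' := mobius (-a)) ⟨fun z hz => mobius_neg_mobius ha hz,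
    fun z hz => ?_⟩ (mapsTo_mobius ha) (mapsTo_mobius ha')⟩
  · exact (analyticAt_id.add analyticAt_const).div
      (analyticAt_const.add (analyticAt_const.mul analyticAt_id)) (mobius_denom_ne ha hz)
  · simpa using mobius_neg_mobius ha' hz

/-- The energy estimate serves twice: for a single monomial it puts `φ_a ^ m` in `H²_β`, and for a
general polynomial it gives the bound that extends by density. -/
theorem compBounded_mobius {w : WeightSeq} (hw : w.PolynomialGrowth) {a : ℝ} (ha0 : 0 ≤ a)
    (ha1 : a < 1) : CompBounded w (mobius a) := by
  obtain ⟨A, hA, h⟩ := hw.exists_sum_compCoeff_le ha0 ha1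
  have hmem : ∀ m, Summable fun k => ‖(mobiusCoeff m k a : ℂ)‖ ^ 2 * w.beta k ^ 2 := fun m => by
    refine summable_of_sum_range_le (c := ‖monomial w m‖ ^ 2 * A) (fun k => by positivity)
      fun N => ?_
    have := h (Finsupp.single m 1) (‖monomial w m‖ ^ 2) (fun N => by
      have hk : ∀ k, Finsupp.single m (1 : ℂ) k = (monomial w m).coeff k := fun k => by
        rw [coeff_monomial, Finsupp.single_apply]
        simp only [eq_comm]
      simp only [hk]
      exact sum_le_norm_sq _ N) N
    simpa [compCoeff, mul_comm] using this
  let U : ℕ → HardySpace w := fun m => ⟨fun k => (mobiusCoeff m k a : ℂ), hmem m⟩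
  refine compBounded_of_monomial (mapsTo_mobius (by rwa [abs_of_nonneg ha0])) U
    (fun m z hz => (hasSum_mobiusCoeff ha0 ha1 hz m).tsum_eq) (Real.sqrt A) fun p => ?_
  refine le_of_sq_le_sq ?_ (by positivity)
  rw [mul_pow, Real.sq_sqrt hA, mul_comm, norm_sq_eq]
  refine Real.tsum_le_of_sum_range_le (fun k => by positivity) fun N => ?_
  have hp : ∀ k, p k = (Finsupp.linearCombination ℂ (monomial w) p).coeff k := fun k => by
    rw [coeff_linearCombination]
    simp [coeff_monomial, Finsupp.sum]
  have := h p (‖Finsupp.linearCombination ℂ (monomial w) p‖ ^ 2) (fun N => by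
    simp only [hp]
    exact sum_le_norm_sq _ N) N
  have hU : ∀ k, (Finsupp.linearCombination ℂ U p).coeff k = compCoeff p k a := fun k =>
    coeff_linearCombination U p k
  simpa only [hU, mul_comm (w.beta _ ^ 2)] using this

/-! ### Rotations and the structure of disc automorphisms -/

theorem isDiscAut_mul_left {c : ℂ} (hc : ‖c‖ = 1) : IsDiscAut (fun z => c * z) := by
  have hc0 : c ≠ 0 := norm_ne_zero_iff.1 (by rw [hc]; exact one_ne_zero)
  refine ⟨analyticOnNhd_const.mul analyticOnNhd_id, Set.InvOn.bijOn (f' := fun z => c⁻¹ * z)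
    ⟨fun z _ => ?_, fun z _ => ?_⟩ (fun z hz => ?_) fun z hz => ?_⟩
  · exact inv_mul_cancel_left₀ hc0 z
  · exact mul_inv_cancel_left₀ hc0 z
  · simpa [hc] using hz
  · simpa [hc] using hz

theorem compBounded_mul_left (w : WeightSeq) {c : ℂ} (hc : ‖c‖ = 1) :
    CompBounded w (fun z => c * z) := by
  have hn : ∀ (f : HardySpace w) (k : ℕ), ‖c ^ k * f.coeff k‖ = ‖f.coeff k‖ := fun f k => by
    rw [norm_mul, norm_pow, hc, one_pow, one_mul]
  let R : HardySpace w → HardySpace w := fun f =>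
    ⟨fun k => c ^ k * f.coeff k, by simp only [hn]; exact f.2⟩
  have hR : ∀ f k, (R f).coeff k = c ^ k * f.coeff k := fun f k => rfl
  refine ⟨LinearMap.mkContinuous
    { toFun := R
      map_add' := fun f g => ext_coeff fun k => ?_
      map_smul' := fun x f => ext_coeff fun k => ?_ } 1 fun f => ?_, fun f z hz => ?_⟩
  · rw [coeff_add, hR, hR, hR, coeff_add, mul_add]
  · rw [RingHom.id_apply, coeff_smul, hR, hR, coeff_smul, mul_left_comm]
  · rw [one_mul]
    refine le_of_sq_le_sq (le_of_eq ?_) (norm_nonneg _)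
    rw [norm_sq_eq, norm_sq_eq]
    exact tsum_congr fun k => by rw [← hn f k]; rfl
  · refine tsum_congr fun k => ?_
    change c ^ k * f.coeff k * z ^ k = f.coeff k * (c * z) ^ k
    rw [mul_pow]
    ring

theorem IsDiscAut.comp {f g : ℂ → ℂ} (hf : IsDiscAut f) (hg : IsDiscAut g) :
    IsDiscAut (f ∘ g) :=
  ⟨hf.1.comp hg.1 hg.2.mapsTo, hf.2.comp hg.2⟩

/-- The inverse of a disc automorphism is a disc automorphism. -/
theorem IsDiscAut.exists_inv {φ : ℂ → ℂ} (hφ : IsDiscAut φ) :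
    ∃ τ : ℂ → ℂ, IsDiscAut τ ∧ Set.InvOn τ φ (Metric.ball 0 1) (Metric.ball 0 1) := by
  obtain ⟨han, hbij⟩ := hφ
  set τ := Function.invFunOn φ (Metric.ball (0 : ℂ) 1)
  have hinv : Set.InvOn τ φ (Metric.ball 0 1) (Metric.ball 0 1) := hbij.invOn_invFunOn
  have hτ : Set.MapsTo τ (Metric.ball 0 1) (Metric.ball 0 1) := hbij.surjOn.mapsTo_invFunOn
  have hpre := (convex_ball (0 : ℂ) 1).isPreconnected
  have h0 : (0 : ℂ) ∈ Metric.ball (0 : ℂ) 1 := by simp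
  have h1 : (1 / 2 : ℂ) ∈ Metric.ball (0 : ℂ) 1 := by norm_num
  have hne : φ 0 ≠ φ (1 / 2) := fun h => by
    have := hbij.injOn h0 h1 h
    norm_num at this
  have hopen : ∀ s ⊆ Metric.ball (0 : ℂ) 1, IsOpen s → IsOpen (φ '' s) := by
    refine (han.is_constant_or_isOpen hpre).resolve_left ?_
    rintro ⟨c, hc⟩
    exact hne ((hc 0 h0).trans (hc _ h1).symm)
  have hcont : ContinuousOn τ (Metric.ball 0 1) := by
    rw [continuousOn_open_iff Metric.isOpen_ball]
    intro t ht
    convert! hopen (Metric.ball 0 1 ∩ t) Set.inter_subset_left (Metric.isOpen_ball.inter ht) using 1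
    ext y
    constructor
    · rintro ⟨hy, hyt⟩
      exact ⟨τ y, ⟨hτ hy, hyt⟩, hinv.2 hy⟩
    · rintro ⟨x, ⟨hx, hxt⟩, rfl⟩
      refine ⟨hbij.mapsTo hx, ?_⟩
      rw [Set.mem_preimage, hinv.1 hx]
      exact hxt
  refine ⟨τ, ⟨fun y hy => ?_, Set.InvOn.bijOn hinv.symm hτ hbij.mapsTo⟩, hinv⟩
  have hcy : ∀ y ∈ Metric.ball (0 : ℂ) 1, ContinuousAt τ y := fun y hy =>
    hcont.continuousAt (Metric.isOpen_ball.mem_nhds hy)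
  -- Zeros of `φ'` are isolated, so the continuous inverse is differentiable on a punctured
  -- neighbourhood and the singularity is removable; `φ' ≠ 0` at the point itself is not needed.
  refine Complex.analyticAt_of_differentiable_on_punctured_nhds_of_continuousAt ?_ (hcy y hy)
  have hd : ∀ᶠ x in 𝓝[≠] (τ y), deriv φ x ≠ 0 := by
    refine (han.deriv _ (hτ hy)).eventually_eq_zero_or_eventually_ne_zero.resolve_left fun h => ?_
    have hz := han.deriv.eqOn_zero_of_preconnected_of_eventuallyEq_zero hpre (hτ hy) h
    exact hne (Metric.isOpen_ball.is_const_of_deriv_eq_zero hpre han.differentiableOn hz h0 h1)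
  have hlim : Tendsto τ (𝓝[≠] y) (𝓝[≠] (τ y)) := by
    refine tendsto_nhdsWithin_iff.2 ⟨(hcy y hy).tendsto.mono_left nhdsWithin_le_nhds, ?_⟩
    filter_upwards [self_mem_nhdsWithin,
      mem_nhdsWithin_of_mem_nhds (Metric.isOpen_ball.mem_nhds hy)] with x hx hxb hxy
    exact hx (by rw [Set.mem_singleton_iff, ← hinv.2 hxb, ← hinv.2 hy, hxy])
  filter_upwards [hlim.eventually hd,
    mem_nhdsWithin_of_mem_nhds (Metric.isOpen_ball.mem_nhds hy)] with x hx hxb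
  refine (HasDerivAt.of_local_left_inverse (hcy x hxb) (han _ (hτ hxb)).differentiableAt.hasDerivAt
    hx ?_).differentiableAt
  filter_upwards [Metric.isOpen_ball.mem_nhds hxb] with v hv
  exact hinv.2 hv

/-- A disc automorphism fixing the origin is a rotation. -/
theorem IsDiscAut.eqOn_rotation {σ : ℂ → ℂ} (hσ : IsDiscAut σ) (h0 : σ 0 = 0) :
    ∃ c : ℂ, ‖c‖ = 1 ∧ Set.EqOn σ (fun z => c * z) (Metric.ball 0 1) := by
  obtain ⟨τ, hτ, hinv⟩ := hσ.exists_inv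
  have hz0 : (0 : ℂ) ∈ Metric.ball (0 : ℂ) 1 := by simp
  have hτ0 : τ 0 = 0 := by
    have := hinv.1 hz0
    rwa [h0] at this
  have hle : ∀ {f : ℂ → ℂ}, IsDiscAut f → f 0 = 0 → ∀ z ∈ Metric.ball (0 : ℂ) 1, ‖f z‖ ≤ ‖z‖ :=
    fun {f} hf hf0 z hz => Complex.norm_le_norm_of_mapsTo_ball hf.1.differentiableOn
      (hf.2.mapsTo.mono_right Metric.ball_subset_closedBall) hf0 (by simpa using hz)
  have heq : ∀ z ∈ Metric.ball (0 : ℂ) 1, ‖σ z‖ = ‖z‖ := fun z hz => by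
    refine (hle hσ h0 z hz).antisymm ?_
    have := hle hτ hτ0 (σ z) (hσ.2.mapsTo hz)
    rwa [hinv.1 hz] at this
  have h1 : (1 / 2 : ℂ) ∈ Metric.ball (0 : ℂ) 1 := by norm_num
  -- Schwarz's lemma for `σ` and its inverse gives `|σ z| = |z|`; equality at the single point `1 /
  -- 2` already forces linearity.
  obtain ⟨c, hc, hE⟩ := Complex.affine_of_mapsTo_ball_of_exists_norm_dslope_eq_div' (R₂ := 1)
    hσ.1.differentiableOn
    (by rw [h0]; exact hσ.2.mapsTo.mono_right Metric.ball_subset_closedBall) ⟨1 / 2, h1, by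
      rw [dslope_of_ne _ (by norm_num), slope_def_field, h0, sub_zero, sub_zero, norm_div,
        heq _ h1]
      norm_num⟩
  refine ⟨c, by simpa using hc, fun z hz => ?_⟩
  have := hE hz
  simpa [h0, mul_comm] using this

/-- Every disc automorphism is a hyperbolic Möbius map composed with rotations. -/
theorem IsDiscAut.exists_eqOn_mobius {φ : ℂ → ℂ} (hφ : IsDiscAut φ) :
    ∃ (a : ℝ) (c d : ℂ), 0 ≤ a ∧ a < 1 ∧ ‖c‖ = 1 ∧ ‖d‖ = 1 ∧
      Set.EqOn φ ((fun z => c * z) ∘ mobius a ∘ fun z => d * z) (Metric.ball 0 1) := by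
  have hz0 : (0 : ℂ) ∈ Metric.ball (0 : ℂ) 1 := by simp
  have ha1 : ‖φ 0‖ < 1 := by simpa using hφ.2.mapsTo hz0
  have ha : |‖φ 0‖| < 1 := by rwa [abs_of_nonneg (norm_nonneg _)]
  have ha' : |-‖φ 0‖| < 1 := by rwa [abs_neg]
  -- Rotating by `c⁻¹` makes the image of `0` the nonnegative real `|φ 0|`, which a real Möbius map
  -- sends to `0`; what remains is a rotation by `d`.
  set c := Complex.exp ((φ 0).arg * Complex.I)
  have hc : ‖c‖ = 1 := Complex.norm_exp_ofReal_mul_I _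
  have hc0 : c ≠ 0 := Complex.exp_ne_zero _
  have hb : φ 0 = ‖φ 0‖ * c := (Complex.norm_mul_exp_arg_mul_I (φ 0)).symm
  have hci : ‖c⁻¹‖ = 1 := by rw [norm_inv, hc, inv_one]
  have hrot := (isDiscAut_mul_left hci).comp hφ
  obtain ⟨d, hd, hE⟩ := ((isDiscAut_mobius ha').comp hrot).eqOn_rotation (by
    have : c⁻¹ * φ 0 = ‖φ 0‖ := by
      rw [inv_mul_eq_div, div_eq_iff hc0]
      exact hb
    simp [mobius, this])
  refine ⟨‖φ 0‖, c, d, norm_nonneg _, ha1, hc, hd, fun z hz => ?_⟩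
  have h1 := mobius_neg_mobius ha' (hrot.2.mapsTo hz)
  have h2 : mobius (-‖φ 0‖) ((fun z => c⁻¹ * z) (φ z)) = d * z := hE hz
  rw [Function.comp_apply, h2, neg_neg] at h1
  simp only [Function.comp_apply]
  rw [h1, mul_inv_cancel_left₀ hc0]

/-! ### Invertibility of composition with automorphisms, and the theorem -/

theorem IsDiscAut.compBounded {w : WeightSeq} (hw : w.PolynomialGrowth) {φ : ℂ → ℂ}
    (hφ : IsDiscAut φ) : CompBounded w φ := by
  obtain ⟨a, c, d, ha0, ha1, hc, hd, hE⟩ := hφ.exists_eqOn_mobius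
  have hm := isDiscAut_mul_left hd
  have ha := isDiscAut_mobius (a := a) (by rwa [abs_of_nonneg ha0])
  exact CompBounded.congr ((compBounded_mul_left w hc).comp
    ((compBounded_mobius hw ha0 ha1).comp (compBounded_mul_left w hd) hm.2.mapsTo)
    (ha.comp hm).2.mapsTo) hE.symm

/-- For weights of polynomial growth, composition with a disc automorphism is invertible. -/
theorem IsDiscAut.compBoundedInvertible {w : WeightSeq} (hw : w.PolynomialGrowth) {φ : ℂ → ℂ}
    (hφ : IsDiscAut φ) : CompBoundedInvertible w φ := by
  obtain ⟨τ, hτ, hinv⟩ := hφ.exists_inv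
  obtain ⟨S, hS⟩ := hφ.compBounded hw
  obtain ⟨T, hT⟩ := hτ.compBounded hw
  refine ⟨ContinuousLinearEquiv.equivOfInverse S T (fun f => ?_) fun f => ?_, hS⟩
  · exact eq_of_eval fun z hz => by rw [hT _ z hz, hS _ _ (hτ.2.mapsTo hz), hinv.2 hz]
  · exact eq_of_eval fun z hz => by rw [hS _ z hz, hT _ _ (hφ.2.mapsTo hz), hinv.1 hz]

/-- The similarity is `C_φ` itself: `C_φ M_{h₁} = M_{h₁ ∘ φ} C_φ`. -/
theorem opSimilar_of_comp {w : WeightSeq} {h₁ h₂ φ : ℂ → ℂ} {S T : HardySpace w →L[ℂ] HardySpace w}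
    (hS : IsMulOp w h₁ S) (hT : IsMulOp w h₂ T)
    (hm : Set.MapsTo φ (Metric.ball 0 1) (Metric.ball 0 1)) (hφ : CompBoundedInvertible w φ)
    (h : Set.EqOn h₂ (h₁ ∘ φ) (Metric.ball 0 1)) : OpSimilar S T := by
  obtain ⟨X, hX⟩ := hφ
  refine ⟨X, fun f => eq_of_eval fun z hz => ?_⟩
  rw [hX _ z hz, hS _ _ (hm hz), hT _ z hz, hX _ z hz, h hz, Function.comp_apply]

end

theorem lemma4p3 (w : WeightSeq) (hw : w.PolynomialGrowth) :
    (∀ (h₁ h₂ : ℂ → ℂ) (hh₁ : h₁ ∈ HolClosedDisc) (hh₂ : h₂ ∈ HolClosedDisc),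
      commutant (mulHol w h₁ hh₁) = commutant (mulZ w) →
      commutant (mulHol w h₂ hh₂) = commutant (mulZ w) →
      (OpSimilar (mulHol w h₁ hh₁) (mulHol w h₂ hh₂) ↔
        ∃ φ : ℂ → ℂ, IsDiscAut φ ∧ Set.EqOn h₂ (h₁ ∘ φ) (Metric.ball 0 1))) ∧
    (∀ (ψ : ℂ → ℂ) (hψ : ψ ∈ HInfty w), AnalyticOnNhd ℂ ψ (Metric.ball 0 1) →
      OpSimilar (mulZ w) (mulOp w ψ hψ) → IsDiscAut ψ) ∧
    (∀ ψ : ℂ → ℂ, AnalyticOnNhd ℂ ψ (Metric.ball 0 1) →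
      Set.MapsTo ψ (Metric.ball 0 1) (Metric.ball 0 1) →
      CompBoundedInvertible w ψ → IsDiscAut ψ) := by
  refine ⟨fun h₁ h₂ hh₁ hh₂ _ hc₂ => ⟨fun h => ?_, ?_⟩, fun ψ hψ han h => ?_,
    fun ψ han hm h => isDiscAut_of_compBoundedInvertible han hm h⟩
  · exact exists_isDiscAut_of_opSimilar (mulOp_spec w _) (mulOp_spec w _) hc₂ h
  · rintro ⟨φ, hφ, hE⟩
    exact opSimilar_of_comp (mulOp_spec w _) (mulOp_spec w _) hφ.2.mapsTo
      (hφ.compBoundedInvertible hw) hE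
  · obtain ⟨X, hX⟩ := h
    exact isDiscAut_of_intertwine han (mulOp_spec w hψ) X hX
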